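/- Let $X$ be a compact Hausdorff space. A $C(X)$-algebra is a $C^*$-algebra $A$ with a unital $*$-homomorphism from $C(X)$ to the centre of the multiplier algebra $M(A)$. For $x\in X$ let $A_x$ be the quotient of $A$ by the closed ideal $C_x(X)A$, where $C_x(X)=\{f\in C(X): f(x)=0\}$. Let $A_1,A_2$ be two $C(X)$-algebras, let $\sigma_i^x:A_i\to (A_i)_x$ be the quotient maps, and let $\mathcal J(A_1,A_2)$ be the involutive ideal of those $\alpha$ in the algebraic tensor product $A_1\otimes_{alg}A_2$ (over $\mathbb C$) with $(\sigma_1^x\otimes\sigma_2^x)(\alpha)=0$ in $(A_1)_x\otimes_{alg}(A_2)_x$ for every $x\in X$. For $\alpha\in A_1\otimes_{alg}A_2$ put $$\|\alpha\|_M=\sup_{x\in X}\bigl\|(\sigma_1^x\otimes\sigma_2^x)(\alpha)\bigr\|_{(A_1)_x\otimes_{\max}(A_2)_x}$$ (with $\sup\emptyset=0$). This $C^*$-semi-norm vanishes on $\mathcal J(A_1,A_2)$ and so induces a $C^*$-semi-norm, still denoted $\|\cdot\|_M$, on $(A_1\otimes_{alg}A_2)/\mathcal J(A_1,A_2)$.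 Then $\|\cdot\|_M$ is the maximal $C^*$-norm on $(A_1\otimes_{alg}A_2)/\mathcal J(A_1,A_2)$: it is a $C^*$-norm, and $\|\cdot\|_\beta\le\|\cdot\|_M$ for every $C^*$-norm $\|\cdot\|_\beta$ on this quotient. Moreover, let $C_\Delta\subset C(X\times X)$ be the ideal of functions vanishing on the diagonal, where $C(X\times X)$ acts on $A_1\otimes_{\max}A_2$ by central multipliers with $(f\otimes g)(a_1\otimes a_2)=fa_1\otimes ga_2$, and let $A_1\otimes^M_{C(X)}A_2$ be the quotient of $A_1\otimes_{\max}A_2$ by the closed ideal $C_\Delta\,(A_1\otimes_{\max}A_2)$. Then the completion of $(A_1\otimes_{alg}A_2)/\mathcal J(A_1,A_2)$ for $\|\cdot\|_M$ is $A_1\otimes^M_{C(X)}A_2$: there is an isometric $*$-isomorphism from the former onto the latter that sends the class of each $\alpha\in A_1\otimes_{alg}A_2$ to the class of $\alpha$. -/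

import Mathlib

set_option linter.unusedVariables false
set_option linter.unusedSectionVars false

open scoped TensorProduct MultiplierAlgebra

noncomputable section

/-! ### C*-seminorms on complex *-algebras -/

/-- A C*-seminorm on a complex *-algebra. -/
structure CStarSeminorm (R : Type*) [NonUnitalRing R] [StarRing R] [Module ℂ R] extends
    Seminorm ℂ R where
  mul_le' : ∀ x y : R, toFun (x * y) ≤ toFun x * toFun y
  star_mul_self' : ∀ x : R, toFun (star x * x) = toFun x ^ 2

namespace CStarSeminorm

variable {R S : Type*} [NonUnitalRing R] [StarRing R] [Module ℂ R]
  [NonUnitalRing S] [StarRing S] [Module ℂ S]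

instance : FunLike (CStarSeminorm R) R ℝ where
  coe p := p.toFun
  coe_injective p q h := by
    cases p; cases q; congr; exact DFunLike.coe_injective h

@[ext] theorem ext {p q : CStarSeminorm R} (h : ∀ x, p x = q x) : p = q := DFunLike.ext _ _ h

instance : PartialOrder (CStarSeminorm R) := PartialOrder.lift (fun p ↦ (p : R → ℝ))
  DFunLike.coe_injective

protected theorem le_def {p q : CStarSeminorm R} : p ≤ q ↔ ∀ x, p x ≤ q x := Iff.rfl

variable (p : CStarSeminorm R)

protected theorem map_add (x y : R) : p (x + y) ≤ p x + p y := p.add_le' x y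
protected theorem map_zero : p 0 = 0 := p.map_zero'
protected theorem map_neg (x : R) : p (-x) = p x := p.neg' x
protected theorem map_smul (c : ℂ) (x : R) : p (c • x) = ‖c‖ * p x := p.smul' c x
protected theorem nonneg (x : R) : 0 ≤ p x := apply_nonneg p.toSeminorm x
protected theorem map_mul (x y : R) : p (x * y) ≤ p x * p y := p.mul_le' x y
protected theorem map_star_mul_self (x : R) : p (star x * x) = p x ^ 2 := p.star_mul_self' x

protected theorem map_star (x : R) : p (star x) = p x := by
  have key : ∀ y : R, p y ≤ p (star y) := fun y ↦ by
    have h := (p.map_star_mul_self y).symm.le.trans (p.map_mul (star y) y)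
    rcases (p.nonneg y).eq_or_lt with h0 | h0
    · rw [← h0]; exact p.nonneg _
    · exact le_of_mul_le_mul_right (by rwa [← sq]) h0
  exact le_antisymm (by simpa using key (star x)) (key x)

/-- A C*-norm is a C*-seminorm that vanishes only at `0`. -/
def IsNorm : Prop := ∀ x : R, p x = 0 → x = 0

instance : Zero (CStarSeminorm R) where
  zero :=
    { (0 : Seminorm ℂ R) with
      mul_le' := fun x y ↦ show (0 : ℝ) ≤ 0 * 0 by simp
      star_mul_self' := fun x ↦ show (0 : ℝ) = 0 ^ 2 by simp }

/-- Pullback of a C*-seminorm along a *-homomorphism. -/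
def comap (q : CStarSeminorm S) (f : R →⋆ₙₐ[ℂ] S) : CStarSeminorm R where
  toFun x := q (f x)
  map_zero' := by simp [q.map_zero]
  add_le' x y := by simpa using q.map_add (f x) (f y)
  neg' x := by simp [q.map_neg]
  smul' c x := by simp [q.map_smul]
  mul_le' x y := by simpa using q.map_mul (f x) (f y)
  star_mul_self' x := by simpa [map_star] using q.map_star_mul_self (f x)

@[simp] theorem comap_apply (q : CStarSeminorm S) (f : R →⋆ₙₐ[ℂ] S) (x : R) :
    q.comap f x = q (f x) := rfl

/-- The pointwise supremum of a pointwise bounded family of C*-seminorms. -/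
protected def iSup {ι : Type*} (p : ι → CStarSeminorm R)
    (hp : ∀ x, BddAbove (Set.range fun i ↦ p i x)) : CStarSeminorm R where
  toFun x := ⨆ i, p i x
  map_zero' := by simp [CStarSeminorm.map_zero]
  add_le' x y := by
    refine Real.iSup_le (fun i ↦ ((p i).map_add x y).trans
      (add_le_add (le_ciSup (hp x) i) (le_ciSup (hp y) i))) ?_
    exact add_nonneg (Real.iSup_nonneg fun i ↦ (p i).nonneg x)
      (Real.iSup_nonneg fun i ↦ (p i).nonneg y)
  neg' x := by simp [CStarSeminorm.map_neg]
  smul' c x := by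
    simp only [CStarSeminorm.map_smul]
    exact (Real.mul_iSup_of_nonneg (norm_nonneg c) _).symm
  mul_le' x y := by
    refine Real.iSup_le (fun i ↦ ((p i).map_mul x y).trans
      (mul_le_mul (le_ciSup (hp x) i) (le_ciSup (hp y) i) ((p i).nonneg y) ?_)) ?_
    · exact Real.iSup_nonneg fun i ↦ (p i).nonneg x
    · exact mul_nonneg (Real.iSup_nonneg fun i ↦ (p i).nonneg x)
        (Real.iSup_nonneg fun i ↦ (p i).nonneg y)
  star_mul_self' x := by
    refine le_antisymm (Real.iSup_le (fun i ↦ ?_) (sq_nonneg _)) ?_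
    · rw [(p i).map_star_mul_self]
      exact pow_le_pow_left₀ ((p i).nonneg x) (le_ciSup (hp x) i) 2
    · have h0 : 0 ≤ ⨆ i, p i (star x * x) := Real.iSup_nonneg fun i ↦ (p i).nonneg _
      rw [← Real.le_sqrt (Real.iSup_nonneg fun i ↦ (p i).nonneg x) h0]
      refine Real.iSup_le (fun i ↦ Real.le_sqrt_of_sq_le ?_) (Real.sqrt_nonneg _)
      rw [← (p i).map_star_mul_self]
      exact le_ciSup (hp (star x * x)) i

theorem iSup_apply {ι : Type*} (p : ι → CStarSeminorm R)
    (hp : ∀ x, BddAbove (Set.range fun i ↦ p i x)) (x : R) :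
    CStarSeminorm.iSup p hp x = ⨆ i, p i x := rfl

end CStarSeminorm

/-- The values of the C*-seminorms at each given element are bounded. -/
class BoundedCStarSeminorms (R : Type*) [NonUnitalRing R] [StarRing R] [Module ℂ R] : Prop where
  bddAbove : ∀ x : R, BddAbove (Set.range fun p : CStarSeminorm R ↦ p x)

/-- The largest C*-seminorm: the supremum of all C*-seminorms. -/
def maxCStarSeminorm (R : Type*) [NonUnitalRing R] [StarRing R] [Module ℂ R]
    [BoundedCStarSeminorms R] : CStarSeminorm R :=
  CStarSeminorm.iSup (fun p : CStarSeminorm R ↦ p) BoundedCStarSeminorms.bddAbove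

theorem le_maxCStarSeminorm {R : Type*} [NonUnitalRing R] [StarRing R] [Module ℂ R]
    [BoundedCStarSeminorms R] (p : CStarSeminorm R) (x : R) : p x ≤ maxCStarSeminorm R x :=
  le_ciSup (BoundedCStarSeminorms.bddAbove x) p

/-- Boundedness passes to targets of surjective *-homomorphisms. -/
theorem BoundedCStarSeminorms.of_surjective {R S : Type*} [NonUnitalRing R] [StarRing R]
    [Module ℂ R] [NonUnitalRing S] [StarRing S] [Module ℂ S] [BoundedCStarSeminorms R]
    (f : R →⋆ₙₐ[ℂ] S) (hf : Function.Surjective f) : BoundedCStarSeminorms S where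
  bddAbove y := by
    obtain ⟨x, rfl⟩ := hf y
    refine ⟨maxCStarSeminorm R x, ?_⟩
    rintro _ ⟨p, rfl⟩
    exact le_maxCStarSeminorm (p.comap f) x

/-! ### The Hausdorff completion for a C*-seminorm -/

section

variable {α : Type*} [NonUnitalSeminormedRing α]

/-- The continuous extension of the multiplication of a non-unital seminormed ring. -/
def complMul (x y : UniformSpace.Completion α) : UniformSpace.Completion α :=
  (UniformSpace.Completion.isDenseInducing_coe.prodMap
    UniformSpace.Completion.isDenseInducing_coe).extend
      ((↑) ∘ Function.uncurry ((· * ·) : α → α → α)) (x, y)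

theorem complMul_coe (x y : α) :
    complMul (x : UniformSpace.Completion α) y = ((x * y : α) : UniformSpace.Completion α) :=
  (UniformSpace.Completion.isDenseInducing_coe.prodMap
    UniformSpace.Completion.isDenseInducing_coe).extend_eq
      ((UniformSpace.Completion.continuous_coe α).comp continuous_mul) (x, y)

theorem continuous_complMul :
    Continuous fun z : UniformSpace.Completion α × UniformSpace.Completion α ↦
      complMul z.1 z.2 := by
  let m := (AddMonoidHom.mul : α →+ α →+ α).compr₂ UniformSpace.Completion.toCompl
  have : Continuous fun z : α × α ↦ m z.1 z.2 :=
    (UniformSpace.Completion.continuous_coe α).comp continuous_mul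
  have di : IsDenseInducing (UniformSpace.Completion.toCompl : α → UniformSpace.Completion α) :=
    UniformSpace.Completion.isDenseInducing_coe
  exact (di.extend_Z_bilin di this :)

end

namespace CStarSeminorm

variable {R : Type*} [NonUnitalRing R] [StarRing R] [Module ℂ R]

/-- The *-algebra `R`, seen as a space seminormed by `p`. -/
def Pre (_p : CStarSeminorm R) : Type _ := R

section Pre

variable (p : CStarSeminorm R)

instance : NonUnitalRing p.Pre := inferInstanceAs (NonUnitalRing R)
instance : StarRing p.Pre := inferInstanceAs (StarRing R)
instance : Module ℂ p.Pre := inferInstanceAs (Module ℂ R)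
instance [IsScalarTower ℂ R R] : IsScalarTower ℂ p.Pre p.Pre :=
  inferInstanceAs (IsScalarTower ℂ R R)
instance [SMulCommClass ℂ R R] : SMulCommClass ℂ p.Pre p.Pre :=
  inferInstanceAs (SMulCommClass ℂ R R)
instance [StarModule ℂ R] : StarModule ℂ p.Pre := inferInstanceAs (StarModule ℂ R)

instance : NonUnitalSeminormedRing p.Pre :=
  { (inferInstance : NonUnitalRing p.Pre),
    AddGroupSeminorm.toSeminormedAddCommGroup (E := p.Pre) p.toAddGroupSeminorm with
    norm_mul_le := p.map_mul }

theorem norm_pre (x : p.Pre) : ‖x‖ = p (show R from x) := rfl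

instance : NormedSpace ℂ p.Pre where
  norm_smul_le c x := (p.map_smul c x).le

instance : NormedStarGroup p.Pre where
  norm_star_le x := (p.map_star x).le

end Pre

/-- The Hausdorff completion of a complex *-algebra for a C*-seminorm. -/
abbrev Completion (p : CStarSeminorm R) : Type _ := UniformSpace.Completion p.Pre

variable (p : CStarSeminorm R)

/-- The canonical map to the completion. -/
def coeC : p.Pre →L[ℂ] p.Completion := UniformSpace.Completion.toComplL

theorem coeC_eq (x : p.Pre) : p.coeC x = (x : UniformSpace.Completion p.Pre) := rfl

theorem norm_coeC (x : p.Pre) : ‖p.coeC x‖ = ‖x‖ := UniformSpace.Completion.norm_coe x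

theorem coeC_smul (c : ℂ) (x : p.Pre) : p.coeC (c • x) = c • p.coeC x := p.coeC.map_smul c x

theorem isDenseInducing_coeC : IsDenseInducing p.coeC :=
  UniformSpace.Completion.isDenseInducing_coe

theorem denseRange_coeC : DenseRange p.coeC := p.isDenseInducing_coeC.dense

/-- Multiplication of the completion: the continuous extension of that of `R`. -/
instance : Mul p.Completion where
  mul x y := complMul (α := p.Pre) x y

theorem coeC_mul (x y : p.Pre) : p.coeC (x * y) = p.coeC x * p.coeC y :=
  (complMul_coe x y).symm

instance : ContinuousMul p.Completion where
  continuous_mul := continuous_complMul (α := p.Pre)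

/-- The involution of the completion: the continuous extension of that of `R`. -/
instance : Star p.Completion where
  star x := UniformSpace.Completion.map (star : p.Pre → p.Pre) x

theorem coeC_star (x : p.Pre) : p.coeC (star x) = star (p.coeC x) :=
  (UniformSpace.Completion.map_coe (f := (star : p.Pre → p.Pre))
    star_isometry.uniformContinuous x).symm

instance : ContinuousStar p.Completion where
  continuous_star := UniformSpace.Completion.continuous_map

theorem ind {P : p.Completion → Prop} (hP : IsClosed {x | P x}) (h : ∀ x, P (p.coeC x))
    (x : p.Completion) : P x :=
  isClosed_property p.denseRange_coeC hP h x

theorem ind₂ {P : p.Completion → p.Completion → Prop}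
    (hP : IsClosed {z : p.Completion × p.Completion | P z.1 z.2})
    (h : ∀ x y, P (p.coeC x) (p.coeC y)) (x y : p.Completion) : P x y :=
  isClosed_property2 p.denseRange_coeC hP h x y

theorem ind₃ {P : p.Completion → p.Completion → p.Completion → Prop}
    (hP : IsClosed {z : p.Completion × p.Completion × p.Completion | P z.1 z.2.1 z.2.2})
    (h : ∀ x y z, P (p.coeC x) (p.coeC y) (p.coeC z)) (x y z : p.Completion) : P x y z :=
  isClosed_property3 p.denseRange_coeC hP h x y z

instance : NonUnitalNormedRing p.Completion :=
  { (inferInstance : NormedAddCommGroup p.Completion), (inferInstance : Mul p.Completion) with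
    zero_mul := p.ind (isClosed_eq (by fun_prop) (by fun_prop)) fun x ↦ by
      rw [← map_zero p.coeC, ← coeC_mul, zero_mul]
    mul_zero := p.ind (isClosed_eq (by fun_prop) (by fun_prop)) fun x ↦ by
      rw [← map_zero p.coeC, ← coeC_mul, mul_zero]
    left_distrib := p.ind₃ (isClosed_eq (by fun_prop) (by fun_prop)) fun x y z ↦ by
      simp only [← map_add p.coeC, ← coeC_mul, mul_add]
    right_distrib := p.ind₃ (isClosed_eq (by fun_prop) (by fun_prop)) fun x y z ↦ by
      simp only [← map_add p.coeC, ← coeC_mul, add_mul]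
    mul_assoc := p.ind₃ (isClosed_eq (by fun_prop) (by fun_prop)) fun x y z ↦ by
      simp only [← coeC_mul, mul_assoc]
    norm_mul_le := p.ind₂ (isClosed_le (by fun_prop) (by fun_prop)) fun x y ↦ by
      simp only [← coeC_mul, norm_coeC]; exact norm_mul_le x y }

instance : StarRing p.Completion where
  star_involutive := p.ind (isClosed_eq (by fun_prop) (by fun_prop)) fun x ↦ by
    simp only [← coeC_star, star_star]
  star_mul := p.ind₂ (isClosed_eq (by fun_prop) (by fun_prop)) fun x y ↦ by
    simp only [← coeC_star, ← coeC_mul, star_mul]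
  star_add := p.ind₂ (isClosed_eq (by fun_prop) (by fun_prop)) fun x y ↦ by
    simp only [← coeC_star, ← map_add p.coeC, star_add]

/-- The canonical *-homomorphism from `R` to its completion. -/
def toCompletion : R →⋆ₙₐ[ℂ] p.Completion where
  toFun x := p.coeC x
  map_smul' c x := p.coeC_smul c x
  map_zero' := map_zero p.coeC
  map_add' x y := map_add p.coeC (show p.Pre from x) (show p.Pre from y)
  map_mul' x y := p.coeC_mul x y
  map_star' x := p.coeC_star x

theorem norm_toCompletion (x : R) : ‖p.toCompletion x‖ = p x := p.norm_coeC x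

theorem denseRange_toCompletion : DenseRange p.toCompletion := p.denseRange_coeC

theorem induction₂ {P : p.Completion → p.Completion → Prop}
    (hP : IsClosed {z : p.Completion × p.Completion | P z.1 z.2})
    (h : ∀ x y : R, P (p.toCompletion x) (p.toCompletion y)) (x y : p.Completion) : P x y :=
  isClosed_property2 p.denseRange_toCompletion hP h x y

instance [IsScalarTower ℂ R R] : IsScalarTower ℂ p.Completion p.Completion where
  smul_assoc c := p.ind₂ (P := fun x y ↦ (c • x) * y = c • (x * y))
    (isClosed_eq (((continuous_const_smul c).comp continuous_fst).mul continuous_snd)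
      ((continuous_const_smul c).comp (continuous_fst.mul continuous_snd))) fun x y ↦ by
      simp only [← coeC_smul, ← coeC_mul, smul_mul_assoc]

instance [SMulCommClass ℂ R R] : SMulCommClass ℂ p.Completion p.Completion where
  smul_comm c := p.ind₂ (P := fun x y ↦ c • (x * y) = x * (c • y))
    (isClosed_eq ((continuous_const_smul c).comp (continuous_fst.mul continuous_snd))
      (continuous_fst.mul ((continuous_const_smul c).comp continuous_snd))) fun x y ↦ by
      simp only [← coeC_smul, ← coeC_mul, mul_smul_comm]

instance [StarModule ℂ R] : StarModule ℂ p.Completion where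
  star_smul c := p.ind (P := fun x ↦ star (c • x) = star c • star x)
    (isClosed_eq (continuous_star.comp (continuous_const_smul c))
      ((continuous_const_smul (star c)).comp continuous_star)) fun x ↦ by
      simp only [← coeC_smul, ← coeC_star, star_smul]

instance : CStarRing p.Completion where
  norm_mul_self_le := p.ind (isClosed_le (by fun_prop) (by fun_prop)) fun x ↦ by
    simp only [← coeC_star, ← coeC_mul, norm_coeC, norm_pre]
    exact (sq (p x) ▸ p.map_star_mul_self x).ge

/-- The completion of a complex *-algebra for a C*-seminorm is a C*-algebra. -/
instance [IsScalarTower ℂ R R] [SMulCommClass ℂ R R] [StarModule ℂ R] :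
    NonUnitalCStarAlgebra p.Completion where

end CStarSeminorm

/-! ### Quotients of complex *-algebras by involutive ideals -/

/-- An involutive two-sided ideal of a complex *-algebra (stable under scalars). -/
structure StarIdeal (R : Type*) [NonUnitalRing R] [StarRing R] [Module ℂ R] extends
    Submodule ℂ R where
  mul_mem_left' : ∀ (x : R) {y : R}, y ∈ carrier → x * y ∈ carrier
  mul_mem_right' : ∀ {x : R} (y : R), x ∈ carrier → x * y ∈ carrier
  star_mem' : ∀ {x : R}, x ∈ carrier → star x ∈ carrier

namespace StarIdeal

variable {R S : Type*} [NonUnitalRing R] [StarRing R] [Module ℂ R]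
  [NonUnitalRing S] [StarRing S] [Module ℂ S]

instance : Membership R (StarIdeal R) where
  mem I x := x ∈ I.toSubmodule

variable (I : StarIdeal R)

theorem mem_toSubmodule {x : R} : x ∈ I.toSubmodule ↔ x ∈ I := Iff.rfl

/-- The quotient *-algebra. -/
abbrev Quot : Type _ := R ⧸ I.toSubmodule

/-- The class of an element in the quotient. -/
abbrev cl (x : R) : I.Quot := Submodule.Quotient.mk x

theorem cl_eq_cl {x y : R} : I.cl x = I.cl y ↔ x - y ∈ I := Submodule.Quotient.eq _

theorem cl_eq_zero {x : R} : I.cl x = 0 ↔ x ∈ I := Submodule.Quotient.mk_eq_zero _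

instance : Mul I.Quot where
  mul := Quotient.map₂ (· * ·) fun a a' ha b b' hb ↦ by
    replace ha := (Submodule.quotientRel_def _).1 ha
    replace hb := (Submodule.quotientRel_def _).1 hb
    refine (Submodule.quotientRel_def _).2 ?_
    have h : a * b - a' * b' = (a - a') * b + a' * (b - b') := by
      rw [sub_mul, mul_sub]; abel
    rw [h]
    exact add_mem (I.mul_mem_right' b ha) (I.mul_mem_left' a' hb)

theorem cl_mul (x y : R) : I.cl (x * y) = I.cl x * I.cl y := rfl

instance : NonUnitalRing I.Quot :=
  { (inferInstance : AddCommGroup I.Quot), (inferInstance : Mul I.Quot) with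
    left_distrib := by
      rintro ⟨a⟩ ⟨b⟩ ⟨c⟩; exact congrArg I.cl (mul_add a b c)
    right_distrib := by
      rintro ⟨a⟩ ⟨b⟩ ⟨c⟩; exact congrArg I.cl (add_mul a b c)
    zero_mul := by rintro ⟨a⟩; exact congrArg I.cl (zero_mul a)
    mul_zero := by rintro ⟨a⟩; exact congrArg I.cl (mul_zero a)
    mul_assoc := by rintro ⟨a⟩ ⟨b⟩ ⟨c⟩; exact congrArg I.cl (mul_assoc a b c) }

instance : Star I.Quot where
  star := Quotient.map star fun a b h ↦ by
    replace h := (Submodule.quotientRel_def _).1 h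
    refine (Submodule.quotientRel_def _).2 ?_
    rw [← star_sub]
    exact I.star_mem' h

theorem cl_star (x : R) : I.cl (star x) = star (I.cl x) := rfl

instance : StarRing I.Quot where
  star_involutive := by rintro ⟨a⟩; exact congrArg I.cl (star_star a)
  star_mul := by rintro ⟨a⟩ ⟨b⟩; exact congrArg I.cl (star_mul a b)
  star_add := by rintro ⟨a⟩ ⟨b⟩; exact congrArg I.cl (star_add a b)

instance [IsScalarTower ℂ R R] : IsScalarTower ℂ I.Quot I.Quot where
  smul_assoc := by rintro c ⟨a⟩ ⟨b⟩; exact congrArg I.cl (smul_mul_assoc c a b)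

instance [SMulCommClass ℂ R R] : SMulCommClass ℂ I.Quot I.Quot where
  smul_comm := by rintro c ⟨a⟩ ⟨b⟩; exact congrArg I.cl (mul_smul_comm c a b).symm

instance [StarModule ℂ R] : StarModule ℂ I.Quot where
  star_smul := by rintro c ⟨a⟩; exact congrArg I.cl (star_smul c a)

/-- The quotient map. -/
def proj : R →⋆ₙₐ[ℂ] I.Quot where
  toFun x := I.cl x
  map_smul' _ _ := rfl
  map_zero' := rfl
  map_add' _ _ := rfl
  map_mul' _ _ := rfl
  map_star' _ := rfl

theorem proj_apply (x : R) : I.proj x = I.cl x := rfl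

theorem proj_surjective : Function.Surjective I.proj := Submodule.Quotient.mk_surjective _

theorem proj_eq_zero {x : R} : I.proj x = 0 ↔ x ∈ I := I.cl_eq_zero

end StarIdeal

namespace CStarSeminorm

variable {R : Type*} [NonUnitalRing R] [StarRing R] [Module ℂ R]

theorem eq_of_sub (p : CStarSeminorm R) {x y : R} (h : p (x - y) = 0) : p x = p y := by
  have h1 := p.map_add (x - y) y
  have h2 := p.map_add (-(x - y)) x
  rw [p.map_neg] at h2
  simp only [sub_add_cancel, h, zero_add, neg_sub] at h1 h2
  exact le_antisymm h1 h2

/-- The C*-seminorm induced on a quotient by a C*-seminorm that vanishes on the ideal. -/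
def descend (p : CStarSeminorm R) (I : StarIdeal R) (h : ∀ x ∈ I, p x = 0) :
    CStarSeminorm I.Quot where
  toFun := Quotient.lift p fun x y hxy ↦ by
    change (Submodule.quotientRel _) x y at hxy
    rw [Submodule.quotientRel_def] at hxy
    exact p.eq_of_sub (h _ hxy)
  map_zero' := p.map_zero
  add_le' := by rintro ⟨x⟩ ⟨y⟩; exact p.map_add x y
  neg' := by rintro ⟨x⟩; exact p.map_neg x
  smul' := by rintro c ⟨x⟩; exact p.map_smul c x
  mul_le' := by rintro ⟨x⟩ ⟨y⟩; exact p.map_mul x y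
  star_mul_self' := by rintro ⟨x⟩; exact p.map_star_mul_self x

theorem descend_proj (p : CStarSeminorm R) (I : StarIdeal R) (h : ∀ x ∈ I, p x = 0) (x : R) :
    p.descend I h (I.proj x) = p x := rfl

end CStarSeminorm

/-! ### Algebraic tensor products of *-homomorphisms -/

section tensorMap

variable {A A' B B' : Type*}
  [NonUnitalRing A] [StarRing A] [Module ℂ A] [IsScalarTower ℂ A A] [SMulCommClass ℂ A A]
  [StarModule ℂ A]
  [NonUnitalRing B] [StarRing B] [Module ℂ B] [IsScalarTower ℂ B B] [SMulCommClass ℂ B B]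
  [StarModule ℂ B]
  [NonUnitalRing A'] [StarRing A'] [Module ℂ A'] [IsScalarTower ℂ A' A'] [SMulCommClass ℂ A' A']
  [StarModule ℂ A']
  [NonUnitalRing B'] [StarRing B'] [Module ℂ B'] [IsScalarTower ℂ B' B'] [SMulCommClass ℂ B' B']
  [StarModule ℂ B']

/-- The algebraic tensor product `f ⊗ g` of two *-homomorphisms. -/
def tensorMap (f : A →⋆ₙₐ[ℂ] A') (g : B →⋆ₙₐ[ℂ] B') : A ⊗[ℂ] B →⋆ₙₐ[ℂ] A' ⊗[ℂ] B' where
  toFun := TensorProduct.map (f : A →ₗ[ℂ] A') (g : B →ₗ[ℂ] B')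
  map_smul' c x := map_smul _ c x
  map_zero' := map_zero _
  map_add' := map_add _
  map_mul' x y := by
    induction x with
    | zero => simp
    | add x₁ x₂ h₁ h₂ => simp only [add_mul, map_add, h₁, h₂]
    | tmul a b =>
      induction y with
      | zero => simp
      | add y₁ y₂ h₁ h₂ => simp only [mul_add, map_add, h₁, h₂]
      | tmul a' b' => simp
  map_star' x := by
    induction x with
    | zero => simp
    | add x₁ x₂ h₁ h₂ => simp only [star_add, map_add, h₁, h₂]
    | tmul a b => simp [map_star]

@[simp] theorem tensorMap_tmul (f : A →⋆ₙₐ[ℂ] A') (g : B →⋆ₙₐ[ℂ] B') (a : A) (b : B) :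
    tensorMap f g (a ⊗ₜ b) = f a ⊗ₜ g b := rfl

theorem tensorMap_surjective {f : A →⋆ₙₐ[ℂ] A'} {g : B →⋆ₙₐ[ℂ] B'}
    (hf : Function.Surjective f) (hg : Function.Surjective g) :
    Function.Surjective (tensorMap f g) :=
  TensorProduct.map_surjective (g := (f : A →ₗ[ℂ] A')) (g' := (g : B →ₗ[ℂ] B')) hf hg

end tensorMap

/-! ### Multipliers -/

namespace DoubleCentralizer

variable {D : Type*} [NonUnitalCStarAlgebra D]

theorem eq_of_forall_mul_eq {y z : D} (h : ∀ x : D, x * y = x * z) : y = z := by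
  rw [← sub_eq_zero, ← CStarRing.star_mul_self_eq_zero_iff, mul_sub, h, sub_self]

theorem eq_of_fst {m n : 𝓜(ℂ, D)} (h : ∀ x, m.fst x = n.fst x) : m = n := by
  have h1 : m.fst = n.fst := ContinuousLinearMap.ext h
  have h2 : m.snd = n.snd := by
    refine ContinuousLinearMap.ext fun x ↦ ?_
    apply star_injective
    refine eq_of_forall_mul_eq fun y ↦ ?_
    apply star_injective
    simp only [star_mul, star_star, m.central, n.central, h1]
  exact DoubleCentralizer.ext ℂ D m n (Prod.ext h1 h2)

theorem fst_mul (m : 𝓜(ℂ, D)) (x y : D) : m.fst (x * y) = m.fst x * y := by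
  refine eq_of_forall_mul_eq fun z ↦ ?_
  rw [← m.central, ← mul_assoc, m.central, mul_assoc]

/-- A multiplier that commutes with left multiplications is central. -/
theorem mem_center_of_fst {z : 𝓜(ℂ, D)} (h : ∀ x y, z.fst (x * y) = x * z.fst y) :
    z ∈ Set.center 𝓜(ℂ, D) := by
  rw [Semigroup.mem_center_iff]
  refine fun m ↦ eq_of_fst fun y ↦ eq_of_forall_mul_eq fun x ↦ ?_
  change x * m.fst (z.fst y) = x * z.fst (m.fst y)
  rw [← m.central, ← h, ← h, m.central]

theorem fst_mul_of_mem_center {z : 𝓜(ℂ, D)} (h : z ∈ Set.center 𝓜(ℂ, D)) (x y : D) :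
    z.fst (x * y) = x * z.fst y := by
  have := congrArg (fun m : 𝓜(ℂ, D) ↦ m.fst y) (Semigroup.mem_center_iff.1 h (x : 𝓜(ℂ, D)))
  exact this.symm

theorem star_fst_of_mem_center {z : 𝓜(ℂ, D)} (h : z ∈ Set.center 𝓜(ℂ, D)) (x : D) :
    star (z.fst x) = (star z).fst (star x) := by
  rw [star_fst, star_star]
  congr 1
  apply star_injective
  refine eq_of_forall_mul_eq fun y ↦ ?_
  apply star_injective
  simp only [star_mul, star_star, z.central]
  rw [← fst_mul, fst_mul_of_mem_center h]

end DoubleCentralizer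

/-! ### Extending actions of unital C*-algebras by multipliers to a completion -/

theorem norm_star_mul_self_le_add {D : Type*} [NonUnitalCStarAlgebra D] (u v : D) :
    ‖star u * u‖ ≤ ‖star u * u + star v * v‖ := by
  let _ := CStarAlgebra.spectralOrder D
  have _ := CStarAlgebra.spectralOrderedRing D
  exact CStarAlgebra.norm_le_norm_of_nonneg_of_le (star_mul_self_nonneg u)
    (le_add_of_nonneg_right (star_mul_self_nonneg v))

namespace CStarSeminorm

variable {R E : Type*} [NonUnitalRing R] [StarRing R] [Module ℂ R]
  [IsScalarTower ℂ R R] [SMulCommClass ℂ R R] [StarModule ℂ R] [CStarAlgebra E]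

/-- If a unital C*-algebra `E` acts on `R` by multipliers, then every C*-seminorm `p` on `R`
satisfies `p (e r) ≤ ‖e‖ p r`. -/
theorem action_le (p : CStarSeminorm R) (l : E →ₐ[ℂ] Module.End ℂ R)
    (hl : ∀ e r s, star (l e r) * s = star r * l (star e) s) (e : E) (r : R) :
    p (l e r) ≤ ‖e‖ * p r := by
  let _ := CStarAlgebra.spectralOrder E
  have _ := CStarAlgebra.spectralOrderedRing E
  have h1 : 0 ≤ algebraMap ℝ E (‖e‖ ^ 2) - star e * e :=
    sub_nonneg.2 CStarAlgebra.star_mul_le_algebraMap_norm_sq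
  obtain ⟨g, hg⟩ := CStarAlgebra.nonneg_iff_eq_star_mul_self.1 h1
  have h2 : ((‖e‖ ^ 2 : ℝ) : ℂ) • (star r * r)
      = star (l e r) * l e r + star (l g r) * l g r := by
    rw [hl, hl, ← Module.End.mul_apply, ← Module.End.mul_apply, ← map_mul, ← map_mul, ← hg,
      ← mul_add, ← LinearMap.add_apply, ← map_add, add_sub_cancel,
      IsScalarTower.algebraMap_apply ℝ ℂ E, AlgHom.commutes, Module.algebraMap_end_apply,
      mul_smul_comm]
    rfl
  have h3 : p (star (l e r) * l e r) ≤ p (((‖e‖ ^ 2 : ℝ) : ℂ) • (star r * r)) := by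
    rw [h2]
    have := norm_star_mul_self_le_add (p.toCompletion (l e r)) (p.toCompletion (l g r))
    simpa only [← map_star, ← map_mul, ← map_add, norm_toCompletion] using this
  rw [p.map_star_mul_self, p.map_smul, p.map_star_mul_self, Complex.norm_real, Real.norm_eq_abs,
    abs_of_nonneg (sq_nonneg _), ← mul_pow] at h3
  exact (sq_le_sq₀ (p.nonneg _) (mul_nonneg (norm_nonneg _) (p.nonneg _))).1 h3

/-- The extension to the completion of a linear map that is bounded for `p`. -/
def extendMap (p : CStarSeminorm R) (T : R →ₗ[ℂ] R) : p.Completion →L[ℂ] p.Completion :=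
  ((p.toCompletion : R →ₗ[ℂ] p.Completion).comp T).extendOfNorm
    (p.toCompletion : R →ₗ[ℂ] p.Completion)

theorem extendMap_coe (p : CStarSeminorm R) (T : R →ₗ[ℂ] R) {C : ℝ}
    (hT : ∀ r, p (T r) ≤ C * p r) (r : R) :
    p.extendMap T (p.toCompletion r) = p.toCompletion (T r) :=
  LinearMap.extendOfNorm_eq (e := (p.toCompletion : R →ₗ[ℂ] p.Completion))
    p.denseRange_toCompletion
    ⟨C, fun x ↦ by
      simpa only [LinearMap.comp_apply, LinearMap.coe_coe, norm_toCompletion] using hT x⟩ r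

/-- The linear map `r ↦ (T r*)*`. -/
def starConj (T : R →ₗ[ℂ] R) : R →ₗ[ℂ] R where
  toFun r := star (T (star r))
  map_add' x y := by simp
  map_smul' c x := by simp

/-- The multiplier of the completion that extends the action of `e`. -/
def actionMultiplier (p : CStarSeminorm R) (l : E →ₐ[ℂ] Module.End ℂ R)
    (hl : ∀ e r s, star (l e r) * s = star r * l (star e) s) (e : E) : 𝓜(ℂ, p.Completion) where
  fst := p.extendMap (l e)
  snd := p.extendMap (starConj (l (star e)))
  central := by
    have h1 := p.action_le l hl e
    have h2 : ∀ r, p (starConj (l (star e)) r) ≤ ‖star e‖ * p r := fun r ↦ by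
      simpa [starConj, p.map_star] using p.action_le l hl (star e) (star r)
    refine p.induction₂ (isClosed_eq ?_ ?_) fun x y ↦ ?_
    · exact ((ContinuousLinearMap.continuous _).comp continuous_fst).mul continuous_snd
    · exact continuous_fst.mul ((ContinuousLinearMap.continuous _).comp continuous_snd)
    · rw [p.extendMap_coe _ h1, p.extendMap_coe _ h2, ← map_mul, ← map_mul]
      congr 1
      change star (l (star e) (star x)) * y = x * l e y
      rw [hl, star_star, star_star]

theorem actionMultiplier_coe (p : CStarSeminorm R) (l : E →ₐ[ℂ] Module.End ℂ R)
    (hl : ∀ e r s, star (l e r) * s = star r * l (star e) s) (e : E) (r : R) :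
    (p.actionMultiplier l hl e).fst (p.toCompletion r) = p.toCompletion (l e r) :=
  p.extendMap_coe _ (p.action_le l hl e) r

theorem multiplier_ext (p : CStarSeminorm R) {m n : 𝓜(ℂ, p.Completion)}
    (h : ∀ r, m.fst (p.toCompletion r) = n.fst (p.toCompletion r)) : m = n :=
  DoubleCentralizer.eq_of_fst <| congrFun <|
    p.denseRange_toCompletion.equalizer m.fst.continuous n.fst.continuous (funext h)

/-- An action of a unital C*-algebra on `R` by multipliers extends to a unital *-homomorphism to
the multiplier algebra of each C*-completion of `R`. -/
def actionHom (p : CStarSeminorm R) (l : E →ₐ[ℂ] Module.End ℂ R)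
    (hl : ∀ e r s, star (l e r) * s = star r * l (star e) s) : E →⋆ₐ[ℂ] 𝓜(ℂ, p.Completion) where
  toFun := p.actionMultiplier l hl
  map_one' := p.multiplier_ext fun r ↦ by rw [actionMultiplier_coe, map_one]; rfl
  map_mul' e f := p.multiplier_ext fun r ↦ by
    rw [actionMultiplier_coe, map_mul, DoubleCentralizer.mul_fst]
    change _ = (p.actionMultiplier l hl e).fst ((p.actionMultiplier l hl f).fst _)
    rw [actionMultiplier_coe, actionMultiplier_coe]; rfl
  map_zero' := p.multiplier_ext fun r ↦ by
    rw [actionMultiplier_coe, map_zero]; exact map_zero p.toCompletion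
  map_add' e f := p.multiplier_ext fun r ↦ by
    rw [actionMultiplier_coe, map_add, DoubleCentralizer.add_fst, LinearMap.add_apply]
    change _ = (p.actionMultiplier l hl e).fst _ + (p.actionMultiplier l hl f).fst _
    rw [actionMultiplier_coe, actionMultiplier_coe]
    exact map_add p.toCompletion _ _
  commutes' c := p.multiplier_ext fun r ↦ by
    rw [actionMultiplier_coe, AlgHom.commutes, DoubleCentralizer.algebraMap_fst]
    exact map_smul p.toCompletion c r
  map_star' e := p.multiplier_ext fun r ↦ by
    rw [actionMultiplier_coe, DoubleCentralizer.star_fst]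
    change _ = star (p.extendMap (starConj (l (star e))) (star (p.toCompletion r)))
    have h2 : ∀ r, p (starConj (l (star e)) r) ≤ ‖star e‖ * p r := fun r ↦ by
      simpa [starConj, p.map_star] using p.action_le l hl (star e) (star r)
    rw [← map_star p.toCompletion, p.extendMap_coe _ h2, ← map_star p.toCompletion]
    simp [starConj]

theorem actionHom_coe (p : CStarSeminorm R) (l : E →ₐ[ℂ] Module.End ℂ R)
    (hl : ∀ e r s, star (l e r) * s = star r * l (star e) s) (e : E) (r : R) :
    (p.actionHom l hl e).fst (p.toCompletion r) = p.toCompletion (l e r) :=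
  p.actionMultiplier_coe l hl e r

theorem actionHom_mem_center (p : CStarSeminorm R) (l : E →ₐ[ℂ] Module.End ℂ R)
    (hl : ∀ e r s, star (l e r) * s = star r * l (star e) s) (e : E)
    (he : ∀ r s, l e (r * s) = r * l e s) :
    p.actionHom l hl e ∈ Set.center 𝓜(ℂ, p.Completion) := by
  refine DoubleCentralizer.mem_center_of_fst (p.induction₂ (isClosed_eq ?_ ?_) fun x y ↦ ?_)
  · exact (ContinuousLinearMap.continuous _).comp (continuous_fst.mul continuous_snd)
  · exact continuous_fst.mul ((ContinuousLinearMap.continuous _).comp continuous_snd)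
  · rw [← map_mul, actionHom_coe, actionHom_coe, ← map_mul]
    exact congrArg p.toCompletion (he x y)

end CStarSeminorm

/-! ### The maximal tensor product of two C*-algebras -/

section Tensor

variable (A B : Type*) [NonUnitalCStarAlgebra A] [NonUnitalCStarAlgebra B]

theorem DoubleCentralizer.star_fst_mul {A : Type*} [NonUnitalCStarAlgebra A] (e : 𝓜(ℂ, A))
    (a c : A) : star (e.fst a) * c = star a * (star e).fst c := by
  rw [DoubleCentralizer.star_fst, ← star_mul, e.central, star_mul, star_star]

/-- The action `e ↦ e ⊗ 1` of the multipliers of `A` on the algebraic tensor product. -/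
def actLeft : 𝓜(ℂ, A) →ₐ[ℂ] Module.End ℂ (A ⊗[ℂ] B) :=
  AlgHom.ofLinearMap
    { toFun := fun e ↦ TensorProduct.map (e.fst : A →ₗ[ℂ] A) LinearMap.id
      map_add' := fun e f ↦ TensorProduct.ext' fun a b ↦ TensorProduct.add_tmul _ _ _
      map_smul' := fun c e ↦ TensorProduct.ext' fun a b ↦ rfl }
    (TensorProduct.ext' fun a b ↦ rfl) (fun e f ↦ TensorProduct.ext' fun a b ↦ rfl)

/-- The action `e ↦ 1 ⊗ e` of the multipliers of `B` on the algebraic tensor product. -/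
def actRight : 𝓜(ℂ, B) →ₐ[ℂ] Module.End ℂ (A ⊗[ℂ] B) :=
  AlgHom.ofLinearMap
    { toFun := fun e ↦ TensorProduct.map LinearMap.id (e.fst : B →ₗ[ℂ] B)
      map_add' := fun e f ↦ TensorProduct.ext' fun a b ↦ TensorProduct.tmul_add _ _ _
      map_smul' := fun c e ↦ TensorProduct.ext' fun a b ↦ TensorProduct.tmul_smul c a (e.fst b) }
    (TensorProduct.ext' fun a b ↦ rfl) (fun e f ↦ TensorProduct.ext' fun a b ↦ rfl)

variable {A B}

@[simp] theorem actLeft_tmul (e : 𝓜(ℂ, A)) (a : A) (b : B) :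
    actLeft A B e (a ⊗ₜ b) = e.fst a ⊗ₜ b := rfl

@[simp] theorem actRight_tmul (e : 𝓜(ℂ, B)) (a : A) (b : B) :
    actRight A B e (a ⊗ₜ b) = a ⊗ₜ e.fst b := rfl

theorem star_actLeft_mul (e : 𝓜(ℂ, A)) (r s : A ⊗[ℂ] B) :
    star (actLeft A B e r) * s = star r * actLeft A B (star e) s := by
  induction r with
  | zero => simp
  | add r₁ r₂ h₁ h₂ => simp only [map_add, star_add, add_mul, h₁, h₂]
  | tmul a b =>
    induction s with
    | zero => simp
    | add s₁ s₂ h₁ h₂ => simp only [map_add, mul_add, h₁, h₂]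
    | tmul a' b' =>
      simp only [actLeft_tmul, TensorProduct.star_tmul, Algebra.TensorProduct.tmul_mul_tmul,
        DoubleCentralizer.star_fst_mul]

theorem star_actRight_mul (e : 𝓜(ℂ, B)) (r s : A ⊗[ℂ] B) :
    star (actRight A B e r) * s = star r * actRight A B (star e) s := by
  induction r with
  | zero => simp
  | add r₁ r₂ h₁ h₂ => simp only [map_add, star_add, add_mul, h₁, h₂]
  | tmul a b =>
    induction s with
    | zero => simp
    | add s₁ s₂ h₁ h₂ => simp only [map_add, mul_add, h₁, h₂]
    | tmul a' b' =>
      simp only [actRight_tmul, TensorProduct.star_tmul, Algebra.TensorProduct.tmul_mul_tmul,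
        DoubleCentralizer.star_fst_mul]

theorem actLeft_mul {e : 𝓜(ℂ, A)} (he : e ∈ Set.center 𝓜(ℂ, A)) (r s : A ⊗[ℂ] B) :
    actLeft A B e (r * s) = r * actLeft A B e s := by
  induction r with
  | zero => simp
  | add r₁ r₂ h₁ h₂ => simp only [map_add, add_mul, h₁, h₂]
  | tmul a b =>
    induction s with
    | zero => simp
    | add s₁ s₂ h₁ h₂ => simp only [map_add, mul_add, h₁, h₂]
    | tmul a' b' =>
      simp only [actLeft_tmul, Algebra.TensorProduct.tmul_mul_tmul,
        DoubleCentralizer.fst_mul_of_mem_center he]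

theorem actRight_mul {e : 𝓜(ℂ, B)} (he : e ∈ Set.center 𝓜(ℂ, B)) (r s : A ⊗[ℂ] B) :
    actRight A B e (r * s) = r * actRight A B e s := by
  induction r with
  | zero => simp
  | add r₁ r₂ h₁ h₂ => simp only [map_add, add_mul, h₁, h₂]
  | tmul a b =>
    induction s with
    | zero => simp
    | add s₁ s₂ h₁ h₂ => simp only [map_add, mul_add, h₁, h₂]
    | tmul a' b' =>
      simp only [actRight_tmul, Algebra.TensorProduct.tmul_mul_tmul,
        DoubleCentralizer.fst_mul_of_mem_center he]

theorem CStarSeminorm.tmul_le (p : CStarSeminorm (A ⊗[ℂ] B)) (a : A) (b : B) :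
    p (a ⊗ₜ b) ≤ ‖a‖ * ‖b‖ := by
  have h1 : p (star (a ⊗ₜ[ℂ] b) * (a ⊗ₜ b)) ≤ ‖a‖ * (‖b‖ * p (a ⊗ₜ b)) := by
    have e1 := p.action_le (actLeft A B) star_actLeft_mul
      (DoubleCentralizer.coe ℂ (star a)) (a ⊗ₜ (star b * b))
    have e2 := p.action_le (actRight A B) star_actRight_mul
      (DoubleCentralizer.coe ℂ (star b)) (a ⊗ₜ b)
    have n1 : ‖(DoubleCentralizer.coe ℂ (star a) : 𝓜(ℂ, A))‖ = ‖a‖ := by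
      rw [← DoubleCentralizer.norm_fst, DoubleCentralizer.coe_fst,
        ContinuousLinearMap.opNorm_mul_apply, norm_star]
    have n2 : ‖(DoubleCentralizer.coe ℂ (star b) : 𝓜(ℂ, B))‖ = ‖b‖ := by
      rw [← DoubleCentralizer.norm_fst, DoubleCentralizer.coe_fst,
        ContinuousLinearMap.opNorm_mul_apply, norm_star]
    rw [n1] at e1
    rw [n2] at e2
    simp only [actLeft_tmul, actRight_tmul, DoubleCentralizer.coe_fst,
      ContinuousLinearMap.mul_apply'] at e1 e2
    rw [TensorProduct.star_tmul, Algebra.TensorProduct.tmul_mul_tmul]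
    exact e1.trans (mul_le_mul_of_nonneg_left e2 (norm_nonneg a))
  rw [p.map_star_mul_self, ← mul_assoc, sq] at h1
  rcases (p.nonneg (a ⊗ₜ b)).eq_or_lt with h0 | h0
  · rw [← h0]; positivity
  · exact le_of_mul_le_mul_right h1 h0

/-- C*-seminorms on the algebraic tensor product of two C*-algebras are pointwise bounded, so that
`maxCStarSeminorm (A ⊗[ℂ] B)` is the maximal C*-norm of `A ⊗[ℂ] B`. -/
instance : BoundedCStarSeminorms (A ⊗[ℂ] B) where
  bddAbove x := by
    induction x with
    | zero => exact ⟨0, by rintro _ ⟨p, rfl⟩; exact p.map_zero.le⟩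
    | add x y hx hy =>
      obtain ⟨c, hc⟩ := hx
      obtain ⟨d, hd⟩ := hy
      refine ⟨c + d, ?_⟩
      rintro _ ⟨p, rfl⟩
      exact (p.map_add x y).trans (add_le_add (hc ⟨p, rfl⟩) (hd ⟨p, rfl⟩))
    | tmul a b => exact ⟨‖a‖ * ‖b‖, by rintro _ ⟨p, rfl⟩; exact p.tmul_le a b⟩

instance (I : StarIdeal A) (J : StarIdeal B) : BoundedCStarSeminorms (I.Quot ⊗[ℂ] J.Quot) :=
  .of_surjective (tensorMap I.proj J.proj)
    (tensorMap_surjective I.proj_surjective J.proj_surjective)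

variable (A B) in
/-- The maximal tensor product of two C*-algebras. -/
abbrev MaxTensor : Type _ := (maxCStarSeminorm (A ⊗[ℂ] B)).Completion

end Tensor

/-! ### `C(X)`-algebras -/

/-- A `C(X)`-algebra: a C*-algebra `A` with a unital *-homomorphism from `C(X)` to the center of
the multiplier algebra of `A`. -/
class CXAlgebra (X A : Type*) [TopologicalSpace X] [NonUnitalCStarAlgebra A] where
  toMultiplier : C(X, ℂ) →⋆ₐ[ℂ] 𝓜(ℂ, A)
  mem_center : ∀ f : C(X, ℂ), toMultiplier f ∈ Set.center 𝓜(ℂ, A)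

namespace CXAlgebra

section

variable {X A : Type*} [TopologicalSpace X] [NonUnitalCStarAlgebra A] [CXAlgebra X A]

/-- The action of a function on an element. -/
def act (f : C(X, ℂ)) (a : A) : A := (toMultiplier f : 𝓜(ℂ, A)).fst a

theorem act_mul (f : C(X, ℂ)) (a b : A) : act f (a * b) = act f a * b :=
  DoubleCentralizer.fst_mul _ a b

theorem mul_act (f : C(X, ℂ)) (a b : A) : a * act f b = act f (a * b) :=
  (DoubleCentralizer.fst_mul_of_mem_center (mem_center f) a b).symm

theorem star_act (f : C(X, ℂ)) (a : A) : star (act f a) = act (star f) (star a) := by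
  rw [act, act, map_star (toMultiplier : C(X, ℂ) →⋆ₐ[ℂ] 𝓜(ℂ, A))]
  exact DoubleCentralizer.star_fst_of_mem_center (mem_center f) a

variable (A) in
/-- The products of elements of `A` with functions vanishing on `Z`. -/
def vanishingProducts (Z : Set X) : Set A :=
  {a | ∃ (f : C(X, ℂ)) (b : A), (∀ z ∈ Z, f z = 0) ∧ a = act f b}

theorem mem_closure_span_of_forall {V : Set A} {T : A → A} (hT : Continuous T)
    (hadd : ∀ a b, T (a + b) = T a + T b) (hsmul : ∀ (c : ℂ) a, ∃ d : ℂ, T (c • a) = d • T a)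
    (hV : ∀ a ∈ V, T a ∈ V) {a : A} (ha : a ∈ (Submodule.span ℂ V).topologicalClosure) :
    T a ∈ (Submodule.span ℂ V).topologicalClosure := by
  refine map_mem_closure hT ha fun b hb ↦ ?_
  change T b ∈ Submodule.span ℂ V
  induction hb using Submodule.span_induction with
  | mem b hb => exact Submodule.subset_span (hV b hb)
  | zero =>
    obtain ⟨d, hd⟩ := hsmul 0 0
    have h0 : T 0 = 0 := by simpa using hadd 0 0
    rw [h0]; exact zero_mem _
  | add b c _ _ hb hc => rw [hadd]; exact add_mem hb hc
  | smul c b _ hb =>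
    obtain ⟨d, hd⟩ := hsmul c b
    rw [hd]; exact Submodule.smul_mem _ d hb

variable (A) in
/-- The closed ideal of `A` generated by the products of elements of `A` with functions vanishing
on `Z`. -/
def vanishingIdeal (Z : Set X) : StarIdeal A where
  toSubmodule := (Submodule.span ℂ (vanishingProducts A Z)).topologicalClosure
  mul_mem_left' x y hy := by
    refine mem_closure_span_of_forall (T := fun y ↦ x * y) (continuous_const.mul continuous_id)
      (fun a b ↦ mul_add x a b) (fun c a ↦ ⟨c, mul_smul_comm c x a⟩) ?_ hy
    rintro _ ⟨f, b, hf, rfl⟩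
    exact ⟨f, x * b, hf, mul_act f x b⟩
  mul_mem_right' {x} y hx := by
    refine mem_closure_span_of_forall (T := fun x ↦ x * y) (continuous_id.mul continuous_const)
      (fun a b ↦ add_mul a b y) (fun c a ↦ ⟨c, smul_mul_assoc c a y⟩) ?_ hx
    rintro _ ⟨f, b, hf, rfl⟩
    exact ⟨f, b * y, hf, (act_mul f b y).symm⟩
  star_mem' {x} hx := by
    refine mem_closure_span_of_forall (T := star) continuous_star
      star_add (fun c a ↦ ⟨star c, star_smul c a⟩) ?_ hx
    rintro _ ⟨f, b, hf, rfl⟩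
    exact ⟨star f, star b, fun z hz ↦ by simp [hf z hz], star_act f b⟩

variable (A) in
/-- The ideal `C_x(X) A`. -/
abbrev fibreIdeal (x : X) : StarIdeal A := vanishingIdeal A {x}

variable (A) in
/-- The fibre `A_x = A / C_x(X) A`. -/
abbrev Fibre (x : X) : Type _ := (fibreIdeal A x).Quot

variable (A) in
/-- The quotient map `A → A_x`. -/
abbrev toFibre (x : X) : A →⋆ₙₐ[ℂ] Fibre A x := (fibreIdeal A x).proj

end

/-! ### The ideal `J(A, B)` and the seminorm `‖ ‖_M` -/

section

variable (X A B : Type*) [TopologicalSpace X] [NonUnitalCStarAlgebra A] [NonUnitalCStarAlgebra B]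
  [CXAlgebra X A] [CXAlgebra X B]

variable {X} in
/-- The map `A ⊗ B → A_x ⊗ B_x`. -/
abbrev evalTensor (x : X) : A ⊗[ℂ] B →⋆ₙₐ[ℂ] Fibre A x ⊗[ℂ] Fibre B x :=
  tensorMap (toFibre A x) (toFibre B x)

/-- The involutive ideal of the elements of `A ⊗ B` that vanish in `A_x ⊗ B_x` for all `x`. -/
def idealJ : StarIdeal (A ⊗[ℂ] B) where
  carrier := {α | ∀ x : X, evalTensor A B x α = 0}
  add_mem' ha hb x := by rw [map_add, ha x, hb x, add_zero]
  zero_mem' x := map_zero _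
  smul_mem' c α ha x := by rw [map_smul, ha x, smul_zero]
  mul_mem_left' α β hb x := by rw [map_mul, hb x, mul_zero]
  mul_mem_right' {α} β ha x := by rw [map_mul, ha x, zero_mul]
  star_mem' {α} ha x := by rw [map_star, ha x, star_zero]

/-- The C*-seminorm `‖α‖_M = sup_x ‖α_x‖`, where `‖ ‖` is the maximal C*-norm of `A_x ⊗ B_x`. -/
def seminormM : CStarSeminorm (A ⊗[ℂ] B) :=
  CStarSeminorm.iSup
    (fun x : X ↦ (maxCStarSeminorm (Fibre A x ⊗[ℂ] Fibre B x)).comap (evalTensor A B x))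
    fun α ↦ ⟨maxCStarSeminorm (A ⊗[ℂ] B) α, by
      rintro _ ⟨x, rfl⟩
      exact le_maxCStarSeminorm _ α⟩

theorem seminormM_apply (α : A ⊗[ℂ] B) : seminormM X A B α =
    ⨆ x : X, maxCStarSeminorm (Fibre A x ⊗[ℂ] Fibre B x) (evalTensor A B x α) := rfl

theorem seminormM_eq_zero (α : A ⊗[ℂ] B) (h : α ∈ idealJ X A B) : seminormM X A B α = 0 := by
  have h' : ∀ x : X, evalTensor A B x α = 0 := h
  simp [seminormM_apply, h', CStarSeminorm.map_zero]

/-- The C*-seminorm induced by `‖ ‖_M` on the quotient of `A ⊗ B` by `J(A, B)`. -/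
def normM : CStarSeminorm (idealJ X A B).Quot :=
  (seminormM X A B).descend (idealJ X A B) (seminormM_eq_zero X A B)

theorem normM_proj (α : A ⊗[ℂ] B) : normM X A B ((idealJ X A B).proj α) =
    ⨆ x : X, maxCStarSeminorm (Fibre A x ⊗[ℂ] Fibre B x) (evalTensor A B x α) := rfl

end

/-! ### The `C(X × X)`-algebra structure of the maximal tensor product -/

section

/-- The center of a unital C*-algebra. -/
def centerSub (M : Type*) [CStarAlgebra M] : StarSubalgebra ℂ M :=
  { Subalgebra.center ℂ M with star_mem' := Set.star_mem_center }

theorem mem_centerSub {M : Type*} [CStarAlgebra M] {z : M} :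
    z ∈ centerSub M ↔ z ∈ Set.center M := Iff.rfl

instance (M : Type*) [CStarAlgebra M] : IsClosed (centerSub M : Set M) := by
  have : (centerSub M : Set M) = ⋂ m : M, {z | m * z = z * m} := by
    ext z
    simp only [SetLike.mem_coe, mem_centerSub, Semigroup.mem_center_iff, Set.mem_iInter,
      Set.mem_ofPred_eq]
  rw [this]
  exact isClosed_iInter fun m ↦ isClosed_eq (by fun_prop) (by fun_prop)

instance (M : Type*) [CStarAlgebra M] : CommCStarAlgebra (centerSub M) :=
  { (inferInstance : CStarAlgebra (centerSub M)) with
    mul_comm := fun z w ↦ Subtype.ext (Semigroup.mem_center_iff.1 w.2 z) }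

open WeakDual.CharacterSpace in
/-- The continuous map to `X` dual to a unital *-homomorphism from `C(X)` to a commutative
C*-algebra. -/
def dualMap {X S : Type*} [TopologicalSpace X] [CompactSpace X] [T2Space X] [CommCStarAlgebra S]
    (φ : C(X, ℂ) →⋆ₐ[ℂ] S) : C(WeakDual.characterSpace ℂ S, X) :=
  ((homeoEval X ℂ).symm : C(WeakDual.characterSpace ℂ C(X, ℂ), X)).comp (compContinuousMap φ)

open WeakDual.CharacterSpace in
theorem dualMap_apply {X S : Type*} [TopologicalSpace X] [CompactSpace X] [T2Space X]
    [CommCStarAlgebra S] (φ : C(X, ℂ) →⋆ₐ[ℂ] S) (χ : WeakDual.characterSpace ℂ S) (f : C(X, ℂ)) :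
    f (dualMap φ χ) = χ (φ f) := by
  have h : homeoEval X ℂ (dualMap φ χ) = compContinuousMap φ χ :=
    (homeoEval X ℂ).apply_symm_apply _
  exact DFunLike.congr_fun h f

/-- The *-homomorphism from `C(X × Y)` with `f ⊗ g ↦ φ f * ψ g`. -/
def prodHom {X Y S : Type*} [TopologicalSpace X] [CompactSpace X] [T2Space X] [TopologicalSpace Y]
    [CompactSpace Y] [T2Space Y] [CommCStarAlgebra S]
    (φ : C(X, ℂ) →⋆ₐ[ℂ] S) (ψ : C(Y, ℂ) →⋆ₐ[ℂ] S) : C(X × Y, ℂ) →⋆ₐ[ℂ] S :=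
  ((gelfandStarTransform S).symm :
      C(WeakDual.characterSpace ℂ S, ℂ) →⋆ₐ[ℂ] S).comp
    (ContinuousMap.compStarAlgHom' ℂ ℂ ((dualMap φ).prodMk (dualMap ψ)))

theorem prodHom_apply {X Y S : Type*} [TopologicalSpace X] [CompactSpace X] [T2Space X]
    [TopologicalSpace Y] [CompactSpace Y] [T2Space Y] [CommCStarAlgebra S]
    (φ : C(X, ℂ) →⋆ₐ[ℂ] S) (ψ : C(Y, ℂ) →⋆ₐ[ℂ] S) (f : C(X, ℂ)) (g : C(Y, ℂ)) :
    prodHom φ ψ (f.comp .fst * g.comp .snd) = φ f * ψ g := by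
  apply (gelfandStarTransform S).injective
  refine ((gelfandStarTransform S).apply_symm_apply _).trans ?_
  ext χ
  change f (dualMap φ χ) * g (dualMap ψ χ) = χ (φ f * ψ g)
  rw [dualMap_apply, dualMap_apply, map_mul]

/-- The structure of a `C(X × Y)`-algebra given by structures `φ` of a `C(X)`-algebra and `ψ` of a
`C(Y)`-algebra. -/
abbrev prodStructure {X Y D : Type*} [TopologicalSpace X] [CompactSpace X] [T2Space X]
    [TopologicalSpace Y] [CompactSpace Y] [T2Space Y] [NonUnitalCStarAlgebra D]
    (φ : CXAlgebra X D) (ψ : CXAlgebra Y D) : CXAlgebra (X × Y) D where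
  toMultiplier := (centerSub 𝓜(ℂ, D)).subtype.comp
    (prodHom (φ.toMultiplier.codRestrict (centerSub 𝓜(ℂ, D)) φ.mem_center)
      (ψ.toMultiplier.codRestrict (centerSub 𝓜(ℂ, D)) ψ.mem_center))
  mem_center h := (prodHom (φ.toMultiplier.codRestrict (centerSub 𝓜(ℂ, D)) φ.mem_center)
      (ψ.toMultiplier.codRestrict (centerSub 𝓜(ℂ, D)) ψ.mem_center) h).2

theorem prodStructure_apply {X Y D : Type*} [TopologicalSpace X] [CompactSpace X] [T2Space X]
    [TopologicalSpace Y] [CompactSpace Y] [T2Space Y] [NonUnitalCStarAlgebra D]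
    (φ : CXAlgebra X D) (ψ : CXAlgebra Y D) (f : C(X, ℂ)) (g : C(Y, ℂ)) :
    (prodStructure φ ψ).toMultiplier (f.comp .fst * g.comp .snd) =
      φ.toMultiplier f * ψ.toMultiplier g :=
  congrArg Subtype.val (prodHom_apply (φ.toMultiplier.codRestrict (centerSub 𝓜(ℂ, D)) φ.mem_center)
      (ψ.toMultiplier.codRestrict (centerSub 𝓜(ℂ, D)) ψ.mem_center) f g)

/-- The `C(X)`-algebra structure of a C*-completion of `R` that extends an action on `R`. -/
abbrev actionStructure {X R E : Type*} [TopologicalSpace X] [NonUnitalRing R] [StarRing R]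
    [Module ℂ R] [IsScalarTower ℂ R R] [SMulCommClass ℂ R R] [StarModule ℂ R] [CStarAlgebra E]
    (p : CStarSeminorm R) (l : E →ₐ[ℂ] Module.End ℂ R)
    (hl : ∀ e r s, star (l e r) * s = star r * l (star e) s) (φ : C(X, ℂ) →⋆ₐ[ℂ] E)
    (hφ : ∀ f r s, l (φ f) (r * s) = r * l (φ f) s) : CXAlgebra X p.Completion where
  toMultiplier := (p.actionHom l hl).comp φ
  mem_center f := p.actionHom_mem_center l hl (φ f) (hφ f)

theorem actionStructure_coe {X R E : Type*} [TopologicalSpace X] [NonUnitalRing R] [StarRing R]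
    [Module ℂ R] [IsScalarTower ℂ R R] [SMulCommClass ℂ R R] [StarModule ℂ R] [CStarAlgebra E]
    (p : CStarSeminorm R) (l : E →ₐ[ℂ] Module.End ℂ R)
    (hl : ∀ e r s, star (l e r) * s = star r * l (star e) s) (φ : C(X, ℂ) →⋆ₐ[ℂ] E)
    (hφ : ∀ f r s, l (φ f) (r * s) = r * l (φ f) s) (f : C(X, ℂ)) (r : R) :
    ((actionStructure p l hl φ hφ).toMultiplier f).fst (p.toCompletion r) =
      p.toCompletion (l (φ f) r) :=
  p.actionHom_coe l hl (φ f) r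

variable (X A B : Type*) [TopologicalSpace X] [CompactSpace X] [T2Space X]
  [NonUnitalCStarAlgebra A] [NonUnitalCStarAlgebra B] [CXAlgebra X A] [CXAlgebra X B]

/-- The `C(X)`-algebra structure `f ↦ f ⊗ 1` on the maximal tensor product. -/
abbrev leftStructure : CXAlgebra X (MaxTensor A B) :=
  actionStructure (maxCStarSeminorm (A ⊗[ℂ] B)) (actLeft A B) star_actLeft_mul toMultiplier
    fun f ↦ actLeft_mul (mem_center f)

/-- The `C(X)`-algebra structure `f ↦ 1 ⊗ f` on the maximal tensor product. -/
abbrev rightStructure : CXAlgebra X (MaxTensor A B) :=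
  actionStructure (maxCStarSeminorm (A ⊗[ℂ] B)) (actRight A B) star_actRight_mul toMultiplier
    fun f ↦ actRight_mul (mem_center f)

theorem leftStructure_tmul (f : C(X, ℂ)) (a : A) (b : B) :
    ((leftStructure X A B).toMultiplier f).fst
      ((maxCStarSeminorm (A ⊗[ℂ] B)).toCompletion (a ⊗ₜ b)) =
      (maxCStarSeminorm (A ⊗[ℂ] B)).toCompletion (act f a ⊗ₜ b) :=
  actionStructure_coe (maxCStarSeminorm (A ⊗[ℂ] B)) (actLeft A B) star_actLeft_mul toMultiplier
    (fun f ↦ actLeft_mul (mem_center f)) f (a ⊗ₜ b)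

theorem rightStructure_tmul (f : C(X, ℂ)) (a : A) (b : B) :
    ((rightStructure X A B).toMultiplier f).fst
      ((maxCStarSeminorm (A ⊗[ℂ] B)).toCompletion (a ⊗ₜ b)) =
      (maxCStarSeminorm (A ⊗[ℂ] B)).toCompletion (a ⊗ₜ act f b) :=
  actionStructure_coe (maxCStarSeminorm (A ⊗[ℂ] B)) (actRight A B) star_actRight_mul toMultiplier
    (fun f ↦ actRight_mul (mem_center f)) f (a ⊗ₜ b)

/-- The maximal tensor product of two `C(X)`-algebras is a `C(X × X)`-algebra, in such a way that
`(f ⊗ g) (a ⊗ b) = f a ⊗ g b`. -/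
instance instMaxTensor : CXAlgebra (X × X) (MaxTensor A B) :=
  prodStructure (leftStructure X A B) (rightStructure X A B)

theorem act_tmul (f g : C(X, ℂ)) (a : A) (b : B) :
    act (f.comp .fst * g.comp .snd : C(X × X, ℂ))
      ((maxCStarSeminorm (A ⊗[ℂ] B)).toCompletion (a ⊗ₜ b)) =
      (maxCStarSeminorm (A ⊗[ℂ] B)).toCompletion (act f a ⊗ₜ act g b) := by
  rw [act, instMaxTensor, prodStructure_apply]
  exact (congrArg _ (rightStructure_tmul X A B g a b)).trans
    (leftStructure_tmul X A B f a (act g b))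

/-- The closed ideal `C_Δ (A ⊗_max B)`, where `C_Δ` is the ideal of `C(X × X)` of the functions
vanishing on the diagonal. -/
abbrev diagonalIdeal : StarIdeal (MaxTensor A B) := vanishingIdeal _ (Set.diagonal X)

/-- The maximal `C(X)`-tensor product: the quotient of `A ⊗_max B` by `C_Δ (A ⊗_max B)`. -/
abbrev MaxCXTensor : Type _ := (diagonalIdeal X A B).Quot

end

end CXAlgebra

end

/-! The proof rests on two facts about C*-algebras over `X`.

First, in a `C(X)`-algebra `D` the norm of `d` is at most the supremum of its fibre norms
(`norm_le_of_forall_toFibre`). If the fibre norm of a self-adjoint `a` is below `c` at `x`, then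
cutting `a` down by a function supported near `x` gives an element of norm below `c`. A partition of
unity with `N` members turns this into `‖a‖ ^ 2 ^ n ≤ N * c ^ 2 ^ n` for all `n`, because the
C*-identity computes the norms of iterated squares; the factor `N` disappears as `n` grows. The
general case follows by passing to `star d * d`, since the fibres carry C*-norms.

Second, the maximal C*-seminorm on each `A_x ⊗ B_x` is a norm
(`maxCStarSeminorm_quot_tensor_isNorm`): tensor products of GNS representations already separate the
points of an algebraic tensor product. Hence an element with `‖α‖_M = 0` vanishes in every `A_x ⊗
B_x`, that is, it lies in `J(A, B)`.

Maximality is `le_seminormM_of_balanced`. If a C*-seminorm `q` on `A ⊗ B` kills every `fa ⊗ b - a ⊗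
fb`, its completion is a `C(X)`-algebra through either factor. The map from `A ⊗ B` to the fibre of
this completion at `x` kills `C_x(X)A ⊗ B` and `A ⊗ C_x(X)B`, so it factors through `A_x ⊗ B_x`,
where the induced seminorm is at most the maximal one. The first fact then gives `q ≤ ‖ ‖_M`. Every
C*-norm on the quotient by `J(A, B)` pulls back to such a `q`, because `f` acts on both fibres at
`x` as the scalar `f x`.

For the completion, the norm of the class of `α` modulo `C_Δ (A ⊗_max B)` equals `‖α‖_M`
(`norm_proj_diagonalIdeal`). It is a seminorm of the above kind, which gives one inequality.
Conversely, the contraction from `A ⊗_max B` to `A_y ⊗_max B_y` turns the action of `F` into the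
scalar `F (y, y)`, by Stone–Weierstrass, so it kills `C_Δ (A ⊗_max B)` and bounds each fibre
seminorm by the quotient norm. An isometric *-homomorphism with dense range into a C*-algebra then
extends to an isomorphism of the completion. -/

noncomputable section

/-! ### Quotients of C*-algebras by closed ideals -/

section Quotient

variable {D : Type*} [NonUnitalCStarAlgebra D]

/-- In the unitization `0 ≤ e ≤ 1`, hence `0 ≤ 1 - e ≤ 1`, and the left-hand element is `z * (1 -
e)`. -/
theorem norm_sub_mul_le_of_nonneg [PartialOrder D] [StarOrderedRing D] {e : D} (h0 : 0 ≤ e)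
    (h1 : ‖e‖ ≤ 1) (z : D) : ‖z - z * e‖ ≤ ‖z‖ := by
  have he : ‖(1 - (e : Unitization ℂ D))‖ ≤ 1 := by
    have h0' : 0 ≤ (e : Unitization ℂ D) := by simpa using h0
    have h1' : (e : Unitization ℂ D) ≤ 1 :=
      (CStarAlgebra.norm_le_one_iff_of_nonneg _ h0').1 (by rwa [Unitization.norm_inr])
    exact (CStarAlgebra.norm_le_one_iff_of_nonneg _ (sub_nonneg.2 h1')).2 (sub_le_self _ h0')
  calc ‖z - z * e‖ = ‖(z : Unitization ℂ D) * (1 - (e : Unitization ℂ D))‖ := by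
        rw [mul_sub, mul_one, ← Unitization.inr_mul, ← Unitization.inr_sub, Unitization.norm_inr]
    _ ≤ ‖(z : Unitization ℂ D)‖ * 1 := (norm_mul_le _ _).trans (by gcongr)
    _ = ‖z‖ := by rw [mul_one, Unitization.norm_inr]

namespace StarIdeal

/-- A closed ideal contains right approximate units of its elements that are self-adjoint and whose
complements are contractive. -/
theorem exists_approx_unit (I : StarIdeal D) (hI : IsClosed (I.toSubmodule : Set D)) {y : D}
    (hy : y ∈ I) {ε : ℝ} (hε : 0 < ε) :
    ∃ e ∈ I, star e = e ∧ (∀ z, ‖z - z * e‖ ≤ ‖z‖) ∧ ‖y - y * e‖ < ε := by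
  -- The closed ideal is itself a C*-algebra, so it has an increasing approximate unit.
  let S : NonUnitalStarSubalgebra ℂ D :=
    { I.toSubmodule with
      mul_mem' := fun {a b} _ hb ↦ I.mul_mem_left' a hb
      star_mem' := fun h ↦ I.star_mem' h }
  have _ : IsClosed (S : Set D) := hI
  let _ := CStarAlgebra.spectralOrder D
  have _ := CStarAlgebra.spectralOrderedRing D
  let _ := CStarAlgebra.spectralOrder S
  have _ := CStarAlgebra.spectralOrderedRing S
  have hl := CStarAlgebra.increasingApproximateUnit S
  have hlim := (hl.tendsto_mul_left ⟨y, hy⟩).eventually (Metric.ball_mem_nhds _ hε)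
  have := hl.neBot
  obtain ⟨e, ⟨h0, h1⟩, h2⟩ := ((hl.eventually_nonneg.and hl.eventually_norm).and hlim).exists
  -- Positivity is known for the spectral order of `S`; writing `e = star s * s` carries it over to
  -- `D`.
  have h0' : 0 ≤ (e : D) := by
    obtain ⟨s, hs⟩ := CStarAlgebra.nonneg_iff_eq_star_mul_self.1 h0
    rw [hs]
    exact star_mul_self_nonneg (s : D)
  refine ⟨e, e.2, (IsSelfAdjoint.of_nonneg h0').star_eq, norm_sub_mul_le_of_nonneg h0' h1, ?_⟩
  rw [← dist_eq_norm, dist_comm]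
  exact h2

/-- The C*-seminorm of the quotient of a C*-algebra by a closed ideal. -/
def quotSeminorm (I : StarIdeal D) (hI : IsClosed (I.toSubmodule : Set D)) :
    CStarSeminorm I.Quot :=
  have hmul : ∀ x y : I.Quot, ‖x * y‖ ≤ ‖x‖ * ‖y‖ := fun x y ↦ by
    refine le_of_forall_pos_le_add fun ε hε ↦ ?_
    have hlim : Filter.Tendsto (fun δ : ℝ ↦ (‖x‖ + δ) * (‖y‖ + δ)) (nhdsWithin 0 (Set.Ioi 0))
        (nhds (‖x‖ * ‖y‖)) := by
      have : Continuous fun δ : ℝ ↦ (‖x‖ + δ) * (‖y‖ + δ) := by fun_prop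
      simpa using (this.tendsto 0).mono_left nhdsWithin_le_nhds
    refine (ge_of_tendsto hlim ?_).trans (le_add_of_nonneg_right hε.le)
    filter_upwards [self_mem_nhdsWithin] with δ hδ
    obtain ⟨a, rfl, ha⟩ := Submodule.Quotient.norm_mk_lt x hδ
    obtain ⟨b, rfl, hb⟩ := Submodule.Quotient.norm_mk_lt y hδ
    calc ‖I.cl (a * b)‖ ≤ ‖a * b‖ := Submodule.Quotient.norm_mk_le _ _
      _ ≤ ‖a‖ * ‖b‖ := norm_mul_le _ _
      _ ≤ _ := mul_le_mul ha.le hb.le (norm_nonneg _) ((norm_nonneg a).trans ha.le)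
  have hstar : ∀ x : I.Quot, ‖star x‖ ≤ ‖x‖ := fun x ↦ by
    refine le_of_forall_pos_le_add fun ε hε ↦ ?_
    obtain ⟨a, rfl, ha⟩ := Submodule.Quotient.norm_mk_lt x hε
    exact (Submodule.Quotient.norm_mk_le _ (star a)).trans ((norm_star a).trans_le ha.le)
  { toFun := fun x ↦ ‖x‖
    map_zero' := norm_zero
    add_le' := norm_add_le
    neg' := norm_neg
    smul' := norm_smul
    mul_le' := hmul
    star_mul_self' := by
      intro x
      refine le_antisymm (((hmul _ _).trans
        (mul_le_mul_of_nonneg_right (hstar x) (norm_nonneg _))).trans_eq (sq _).symm) ?_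
      obtain ⟨x, rfl⟩ := I.proj_surjective x
      refine le_of_forall_pos_le_add fun ε hε ↦ ?_
      -- The lift `m` of the class of `star x * x` has almost minimal norm, and `e` almost fixes the
      -- error `m - star x * x` in the ideal. Multiplication by `1 - e` on both sides leaves the
      -- class unchanged, is contractive, and makes that error small.
      obtain ⟨m, hm, hm'⟩ := Submodule.Quotient.norm_mk_lt (star (I.proj x) * I.proj x)
        (half_pos hε)
      have hy : m - star x * x ∈ I := I.cl_eq_cl.1 hm
      obtain ⟨e, heI, hes, hec, hey⟩ := I.exists_approx_unit hI hy (half_pos hε)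
      have hcl : ‖I.proj x‖ ≤ ‖x - x * e‖ := by
        have : I.proj x = I.cl (x - x * e) := by
          refine I.cl_eq_cl.2 ?_
          rw [sub_sub_cancel]
          exact I.mul_mem_left' x heI
        rw [this]
        exact Submodule.Quotient.norm_mk_le _ _
      have hel : ∀ z, ‖z - e * z‖ ≤ ‖z‖ := fun z ↦ by
        rw [← norm_star, star_sub, star_mul, hes, ← norm_star z]
        exact hec _
      calc ‖I.proj x‖ ^ 2 ≤ ‖x - x * e‖ ^ 2 := pow_le_pow_left₀ (norm_nonneg _) hcl 2
        _ = ‖(star x * x - star x * x * e) - e * (star x * x - star x * x * e)‖ := by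
          rw [sq, ← CStarRing.norm_star_mul_self]
          congr 1
          rw [star_sub, star_mul, hes]
          noncomm_ring
        _ ≤ ‖star x * x - star x * x * e‖ := hel _
        _ = ‖(m - m * e) - ((m - star x * x) - (m - star x * x) * e)‖ := by
          congr 1; noncomm_ring
        _ ≤ ‖m‖ + ε / 2 := (norm_sub_le _ _).trans (add_le_add (hec m) hey.le)
        _ ≤ ‖star (I.proj x) * I.proj x‖ + ε := by linarith }

theorem quotSeminorm_apply (I : StarIdeal D) (hI : IsClosed (I.toSubmodule : Set D))
    (x : I.Quot) : I.quotSeminorm hI x = ‖x‖ := rfl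

theorem quotSeminorm_isNorm (I : StarIdeal D) (hI : IsClosed (I.toSubmodule : Set D)) :
    (I.quotSeminorm hI).IsNorm := fun _ hx ↦ norm_eq_zero.1 hx

end StarIdeal

end Quotient

/-! ### Positive functionals separate points -/

section Functionals

variable {A : Type*} [NonUnitalCStarAlgebra A]

-- The positive cone is closed and convex and does not contain `-a`, so Hahn–Banach gives a real
-- functional that is nonnegative on the cone and negative at `-a`; its complexification is the
-- required functional.
open scoped ComplexOrder in
theorem exists_positiveLinearMap_ne_zero [PartialOrder A] [StarOrderedRing A] {a : A} (ha : 0 ≤ a)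
    (hne : a ≠ 0) : ∃ f : A →ₚ[ℂ] ℂ, f a ≠ 0 := by
  have hneg : -a ∉ ProperCone.positive ℝ A := fun h ↦
    hne (le_antisymm (neg_nonneg.1 (ProperCone.mem_positive.1 h)) ha)
  obtain ⟨φ, hφ, hφa⟩ := (ProperCone.positive ℝ A).hyperplane_separation_point hneg
  -- The complex linear extension of the restriction of `φ` to self-adjoint elements.
  let g : A →ₗ[ℂ] ℂ :=
    { toFun := fun x ↦ (φ (realPart x : A) : ℂ) + Complex.I * (φ (imaginaryPart x : A) : ℂ)
      map_add' := fun x y ↦ by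
        simp only [map_add, AddSubgroup.coe_add, Complex.ofReal_add]; ring
      map_smul' := fun c x ↦ by
        simp only [realPart_smul, imaginaryPart_smul, AddSubgroupClass.coe_sub,
          AddSubgroup.coe_add, selfAdjoint.val_smul, map_sub, map_add, map_smul, smul_eq_mul,
          RingHom.id_apply]
        apply Complex.ext <;> simp }
  have hg : ∀ x : A, 0 ≤ x → g x = (φ x : ℂ) := fun x hx ↦ by
    have hsa : IsSelfAdjoint x := .of_nonneg hx
    change (φ (realPart x : A) : ℂ) + Complex.I * (φ (imaginaryPart x : A) : ℂ) = _
    rw [hsa.coe_realPart, hsa.imaginaryPart]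
    simp
  refine ⟨PositiveLinearMap.mk₀ g fun x hx ↦ ?_, ?_⟩
  · rw [hg x hx]
    exact_mod_cast hφ x (ProperCone.mem_positive.2 hx)
  · change g a ≠ 0
    rw [hg a ha]
    rw [map_neg] at hφa
    exact_mod_cast (neg_lt_zero.1 hφa).ne'

open scoped ComplexOrder in
/-- The linear functionals `a ↦ ⟪η, π a ξ⟫`, where `π` is the GNS representation of a positive
linear functional. -/
def vectorFunctionals (A : Type*) [NonUnitalCStarAlgebra A] [PartialOrder A] [StarOrderedRing A] :
    Set (A →ₗ[ℂ] ℂ) :=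
  {f | ∃ (φ : A →ₚ[ℂ] ℂ) (ξ η : φ.GNS), ∀ a, f a = inner ℂ η (φ.gnsNonUnitalStarAlgHom a ξ)}

-- Without a unit there need be no cyclic vector given by `1`, so the class of `star a` serves
-- instead: `π a` sends it to the class of `b = a * star a`, whose squared norm `φ (star b * b)` is
-- nonzero for a suitable `φ`.
open scoped ComplexOrder in
theorem eq_zero_of_vectorFunctionals [PartialOrder A] [StarOrderedRing A] {a : A}
    (h : ∀ f ∈ vectorFunctionals A, f a = 0) : a = 0 := by
  by_contra hne
  let b := a * star a
  have hb : b ≠ 0 := (CStarRing.mul_star_self_eq_zero_iff a).not.2 hne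
  have hb' : star b * b ≠ 0 := (CStarRing.star_mul_self_eq_zero_iff b).not.2 hb
  obtain ⟨φ, hφ⟩ := exists_positiveLinearMap_ne_zero (star_mul_self_nonneg b) hb'
  let ξ : φ.GNS := ((φ.toPreGNS (star a) : φ.PreGNS) : φ.GNS)
  let f : A →ₗ[ℂ] ℂ :=
    { toFun := fun c ↦ inner ℂ (φ.gnsNonUnitalStarAlgHom a ξ) (φ.gnsNonUnitalStarAlgHom c ξ)
      map_add' := fun x y ↦ by simp [inner_add_right]
      map_smul' := fun c x ↦ by simp [inner_smul_right] }
  refine hφ ?_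
  have := h f ⟨φ, ξ, _, fun _ ↦ rfl⟩
  change inner ℂ (φ.gnsNonUnitalStarAlgHom a ξ) (φ.gnsNonUnitalStarAlgHom a ξ) = 0 at this
  rw [PositiveLinearMap.gnsNonUnitalStarAlgHom_apply_coe, UniformSpace.Completion.inner_coe,
    PositiveLinearMap.preGNS_inner_def] at this
  exact this

end Functionals

/-! ### The maximal C*-seminorm of a tensor product is a norm -/

section Separation

/-- Separating sets of linear functionals on the factors separate the points of a tensor product. -/
theorem TensorProduct.eq_zero_of_separating {𝕜 V W : Type*} [Field 𝕜] [AddCommGroup V]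
    [Module 𝕜 V] [AddCommGroup W] [Module 𝕜 W] {F : Set (V →ₗ[𝕜] 𝕜)} {G : Set (W →ₗ[𝕜] 𝕜)}
    (hF : ∀ v, (∀ f ∈ F, f v = 0) → v = 0) (hG : ∀ w, (∀ g ∈ G, g w = 0) → w = 0)
    {t : V ⊗[𝕜] W} (ht : ∀ f ∈ F, ∀ g ∈ G, LinearMap.mul' 𝕜 𝕜 (TensorProduct.map f g t) = 0) :
    t = 0 := by
  classical
  -- In coordinates of a basis of `W`, `t` is a finite family in `V`. Applying `f` to these
  -- coordinates gives the coordinates of the slice `(f ⊗ id) t` in `W`, which the functionals of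
  -- `G` annihilate.
  let b := Module.Basis.ofVectorSpace 𝕜 W
  apply (TensorProduct.equivFinsuppOfBasisRight (M := V) b).injective
  rw [map_zero]
  ext i
  refine hF _ fun f hf ↦ ?_
  have h1 : TensorProduct.lid 𝕜 W (f.rTensor W t) = 0 := hG _ fun g hg ↦ by
    rw [← ht f hf g hg]
    clear ht
    induction t with
    | zero => simp
    | add x y hx hy => simp only [map_add, hx, hy]
    | tmul v w => simp
  have h2 : f (TensorProduct.equivFinsuppOfBasisRight (M := V) b t i) =
      b.repr (TensorProduct.lid 𝕜 W (f.rTensor W t)) i := by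
    clear h1 ht
    induction t with
    | zero => simp
    | add x y hx hy => simp only [map_add, Finsupp.add_apply, hx, hy]
    | tmul v w => simp [mul_comm]
  rw [h2, h1]
  simp

/-- The operator norm of a *-representation of a *-algebra by bounded operators on a (not
necessarily complete) inner product space. -/
def CStarSeminorm.ofRep {R W : Type*} [NonUnitalRing R] [StarRing R] [Module ℂ R]
    [NormedAddCommGroup W] [InnerProductSpace ℂ W] (L : R →ₗ[ℂ] (W →L[ℂ] W))
    (hL : ∀ s t, L (s * t) = L s * L t)
    (hadj : ∀ t v w, inner ℂ (L t v) w = inner ℂ v (L (star t) w)) : CStarSeminorm R :=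
  -- Cauchy–Schwarz applied to `‖L t v‖ ^ 2 = ⟪v, L (star t * t) v⟫`. The adjoint of `L t` is
  -- supplied by `L (star t)`, so completeness of `W` plays no role.
  have key : ∀ t : R, ‖L t‖ ^ 2 ≤ ‖L (star t * t)‖ := fun t ↦ by
    refine (Real.le_sqrt (norm_nonneg _) (norm_nonneg _)).1 ?_
    refine ContinuousLinearMap.opNorm_le_bound _ (Real.sqrt_nonneg _) fun v ↦ ?_
    refine (sq_le_sq₀ (by positivity) (by positivity)).1 ?_
    rw [mul_pow, Real.sq_sqrt (norm_nonneg _), ← inner_self_eq_norm_sq (𝕜 := ℂ), hadj,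
      ← mul_apply_eq_comp, ← hL]
    calc RCLike.re (inner ℂ v (L (star t * t) v))
        ≤ ‖v‖ * ‖L (star t * t) v‖ := re_inner_le_norm _ _
      _ ≤ ‖v‖ * (‖L (star t * t)‖ * ‖v‖) := by
        gcongr; exact ContinuousLinearMap.le_opNorm _ _
      _ = _ := by ring
  have hmul : ∀ s t : R, ‖L (s * t)‖ ≤ ‖L s‖ * ‖L t‖ := fun s t ↦ by
    rw [hL]; exact norm_mul_le _ _
  have hle : ∀ t : R, ‖L t‖ ≤ ‖L (star t)‖ := fun t ↦ by
    rcases (norm_nonneg (L t)).eq_or_lt with h0 | h0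
    · rw [← h0]; exact norm_nonneg _
    · refine le_of_mul_le_mul_right ?_ h0
      rw [← sq]
      exact (key t).trans (hmul _ _)
  { toFun := fun t ↦ ‖L t‖
    map_zero' := by simp
    add_le' := fun s t ↦ by rw [map_add]; exact norm_add_le _ _
    neg' := fun t ↦ by rw [map_neg, norm_neg]
    smul' := fun c t ↦ by rw [map_smul, norm_smul]
    mul_le' := hmul
    star_mul_self' := fun t ↦ by
      refine le_antisymm ((hmul _ _).trans ?_) (key t)
      rw [sq]
      gcongr
      simpa using hle (star t) }

theorem CStarSeminorm.ofRep_eq_zero {R W : Type*} [NonUnitalRing R] [StarRing R] [Module ℂ R]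
    [NormedAddCommGroup W] [InnerProductSpace ℂ W] {L : R →ₗ[ℂ] (W →L[ℂ] W)}
    {hL : ∀ s t, L (s * t) = L s * L t}
    {hadj : ∀ t v w, inner ℂ (L t v) w = inner ℂ v (L (star t) w)} {t : R}
    (h : CStarSeminorm.ofRep L hL hadj t = 0) : L t = 0 := norm_eq_zero.1 h

/-! ### Tensor products of representations, and faithfulness of the maximal seminorm -/

variable {A B H K : Type*} [NonUnitalCStarAlgebra A] [NonUnitalCStarAlgebra B]
  [NormedAddCommGroup H] [InnerProductSpace ℂ H] [CompleteSpace H]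
  [NormedAddCommGroup K] [InnerProductSpace ℂ K] [CompleteSpace K]

/-- The tensor product of two representations, on the algebraic tensor product of the spaces. -/
def tensorRep (π : A →⋆ₙₐ[ℂ] (H →L[ℂ] H)) (ρ : B →⋆ₙₐ[ℂ] (K →L[ℂ] K)) :
    A ⊗[ℂ] B →ₗ[ℂ] (H ⊗[ℂ] K →L[ℂ] H ⊗[ℂ] K) :=
  TensorProduct.lift <| LinearMap.mk₂ ℂ (fun a b ↦ TensorProduct.mapL (π a) (ρ b))
    (fun a a' b ↦ by rw [map_add, TensorProduct.mapL_add_left])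
    (fun c a b ↦ by rw [map_smul, TensorProduct.mapL_smul_left])
    (fun a b b' ↦ by rw [map_add, TensorProduct.mapL_add_right])
    (fun c a b ↦ by rw [map_smul, TensorProduct.mapL_smul_right])

theorem tensorRep_tmul (π : A →⋆ₙₐ[ℂ] (H →L[ℂ] H)) (ρ : B →⋆ₙₐ[ℂ] (K →L[ℂ] K)) (a : A) (b : B) :
    tensorRep π ρ (a ⊗ₜ b) = TensorProduct.mapL (π a) (ρ b) := rfl

theorem tensorRep_mul (π : A →⋆ₙₐ[ℂ] (H →L[ℂ] H)) (ρ : B →⋆ₙₐ[ℂ] (K →L[ℂ] K))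
    (s t : A ⊗[ℂ] B) : tensorRep π ρ (s * t) = tensorRep π ρ s * tensorRep π ρ t := by
  induction s with
  | zero => simp
  | add x y hx hy => simp only [add_mul, map_add, hx, hy]
  | tmul a b =>
    induction t with
    | zero => simp
    | add x y hx hy => simp only [mul_add, map_add, hx, hy]
    | tmul a' b' =>
      rw [Algebra.TensorProduct.tmul_mul_tmul, tensorRep_tmul, tensorRep_tmul, tensorRep_tmul,
        map_mul, map_mul, TensorProduct.mapL_mul]

theorem inner_tensorRep (π : A →⋆ₙₐ[ℂ] (H →L[ℂ] H)) (ρ : B →⋆ₙₐ[ℂ] (K →L[ℂ] K))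
    (t : A ⊗[ℂ] B) (v w : H ⊗[ℂ] K) :
    inner ℂ (tensorRep π ρ t v) w = inner ℂ v (tensorRep π ρ (star t) w) := by
  induction t with
  | zero => simp
  | add x y hx hy =>
    simp only [map_add, star_add, add_apply, inner_add_left, inner_add_right,
      hx, hy]
  | tmul a b =>
    rw [TensorProduct.star_tmul, tensorRep_tmul, tensorRep_tmul]
    induction v with
    | zero => simp
    | add x y hx hy => simp only [map_add, inner_add_left, hx, hy]
    | tmul ξ η =>
      induction w with
      | zero => simp
      | add x y hx hy => simp only [map_add, inner_add_right, hx, hy]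
      | tmul ξ' η' =>
        simp only [TensorProduct.mapL_tmul, TensorProduct.inner_tmul, map_star,
          ContinuousLinearMap.star_eq_adjoint, ContinuousLinearMap.adjoint_inner_right]

/-- The C*-seminorm on a tensor product given by the tensor product of two representations. -/
def tensorRepSeminorm (π : A →⋆ₙₐ[ℂ] (H →L[ℂ] H)) (ρ : B →⋆ₙₐ[ℂ] (K →L[ℂ] K)) :
    CStarSeminorm (A ⊗[ℂ] B) :=
  .ofRep (tensorRep π ρ) (tensorRep_mul π ρ) (inner_tensorRep π ρ)

-- The maximal seminorm dominates the operator seminorm of every pair of GNS representations. An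
-- element that it kills therefore has zero matrix coefficients, and these are the values of the
-- functionals `f ⊗ g` with `f`, `g` in the separating sets `vectorFunctionals`.
variable (A B) in
open scoped ComplexOrder in
theorem maxCStarSeminorm_tensor_isNorm : (maxCStarSeminorm (A ⊗[ℂ] B)).IsNorm := by
  intro t ht
  let _ := CStarAlgebra.spectralOrder A
  have _ := CStarAlgebra.spectralOrderedRing A
  let _ := CStarAlgebra.spectralOrder B
  have _ := CStarAlgebra.spectralOrderedRing B
  refine TensorProduct.eq_zero_of_separating (F := vectorFunctionals A) (G := vectorFunctionals B)
    (fun a ↦ eq_zero_of_vectorFunctionals) (fun b ↦ eq_zero_of_vectorFunctionals) ?_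
  rintro f ⟨φ, ξ, ξ', hf⟩ g ⟨ψ, η, η', hg⟩
  have h0 : tensorRep φ.gnsNonUnitalStarAlgHom ψ.gnsNonUnitalStarAlgHom t = 0 :=
    CStarSeminorm.ofRep_eq_zero (le_antisymm
      ((le_maxCStarSeminorm (tensorRepSeminorm _ _) t).trans_eq ht) (CStarSeminorm.nonneg _ t))
  have h1 : ∀ s : A ⊗[ℂ] B, LinearMap.mul' ℂ ℂ (TensorProduct.map f g s) = inner ℂ (ξ' ⊗ₜ[ℂ] η')
      (tensorRep φ.gnsNonUnitalStarAlgHom ψ.gnsNonUnitalStarAlgHom s (ξ ⊗ₜ η)) := fun s ↦ by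
    induction s with
    | zero => simp
    | add x y hx hy =>
      simp only [map_add, add_apply, inner_add_right, hx, hy]
    | tmul a b =>
      rw [tensorRep_tmul, TensorProduct.mapL_tmul, TensorProduct.inner_tmul,
        TensorProduct.map_tmul, LinearMap.mul'_apply, hf, hg]
  rw [h1, h0]
  simp

/-- The quotients embed in C*-algebras, and over a field the tensor product of two injective maps is
injective. The maximal norm of the larger tensor product pulls back to a C*-norm, which the maximal
seminorm dominates. -/
theorem maxCStarSeminorm_quot_tensor_isNorm (I : StarIdeal A) (J : StarIdeal B)
    (hI : IsClosed (I.toSubmodule : Set A)) (hJ : IsClosed (J.toSubmodule : Set B)) :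
    (maxCStarSeminorm (I.Quot ⊗[ℂ] J.Quot)).IsNorm := by
  intro t ht
  let i := (I.quotSeminorm hI).toCompletion
  let j := (J.quotSeminorm hJ).toCompletion
  have hi : Function.Injective i := (injective_iff_map_eq_zero i).2 fun x hx ↦
    I.quotSeminorm_isNorm hI x (by rw [← CStarSeminorm.norm_toCompletion]; exact norm_eq_zero.2 hx)
  have hj : Function.Injective j := (injective_iff_map_eq_zero j).2 fun x hx ↦
    J.quotSeminorm_isNorm hJ x (by rw [← CStarSeminorm.norm_toCompletion]; exact norm_eq_zero.2 hx)
  have hij : Function.Injective (tensorMap i j) :=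
    TensorProduct.map_injective_of_flat_flat (i : I.Quot →ₗ[ℂ] (I.quotSeminorm hI).Completion)
      (j : J.Quot →ₗ[ℂ] (J.quotSeminorm hJ).Completion) hi hj
  apply hij
  rw [map_zero]
  apply maxCStarSeminorm_tensor_isNorm
  exact le_antisymm ((le_maxCStarSeminorm ((maxCStarSeminorm _).comap (tensorMap i j)) t).trans_eq
    ht) (CStarSeminorm.nonneg _ _)

end Separation

/-! ### The norm of a `C(X)`-algebra is the supremum of the norms of the fibres -/

namespace CXAlgebra

/-! ### The action of `C(X)`, its vanishing ideals and the fibres -/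

section Action

variable {X D : Type*} [TopologicalSpace X] [NonUnitalCStarAlgebra D] [CXAlgebra X D]

theorem act_add (f : C(X, ℂ)) (a b : D) : act f (a + b) = act f a + act f b :=
  map_add (toMultiplier f : 𝓜(ℂ, D)).fst a b

theorem act_smul (f : C(X, ℂ)) (c : ℂ) (a : D) : act f (c • a) = c • act f a :=
  map_smul (toMultiplier f : 𝓜(ℂ, D)).fst c a

theorem add_act (f g : C(X, ℂ)) (a : D) : act (f + g) a = act f a + act g a := by
  rw [act, map_add]; rfl

theorem sub_act (f g : C(X, ℂ)) (a : D) : act (f - g) a = act f a - act g a := by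
  rw [act, map_sub]; rfl

theorem one_act (a : D) : act (1 : C(X, ℂ)) a = a := by
  rw [act, map_one]; rfl

theorem mul_act_act (f g : C(X, ℂ)) (a : D) : act (f * g) a = act f (act g a) := by
  rw [act, map_mul]; rfl

theorem algebraMap_act (c : ℂ) (a : D) : act (algebraMap ℂ C(X, ℂ) c) a = c • a := by
  rw [act, AlgHomClass.commutes]; rfl

theorem sum_act {ι : Type*} (s : Finset ι) (f : ι → C(X, ℂ)) (a : D) :
    act (∑ i ∈ s, f i) a = ∑ i ∈ s, act (f i) a := by
  classical
  induction s using Finset.induction_on with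
  | empty => rw [Finset.sum_empty, Finset.sum_empty, act, map_zero]; rfl
  | insert i s hi h => rw [Finset.sum_insert hi, Finset.sum_insert hi, add_act, h]

theorem continuous_act (f : C(X, ℂ)) : Continuous (act f : D → D) :=
  (toMultiplier f : 𝓜(ℂ, D)).fst.continuous

theorem norm_act_le [CompactSpace X] (f : C(X, ℂ)) (a : D) : ‖act f a‖ ≤ ‖f‖ * ‖a‖ := by
  refine ((toMultiplier f : 𝓜(ℂ, D)).fst.le_opNorm a).trans ?_
  rw [DoubleCentralizer.norm_fst]
  gcongr
  exact NonUnitalStarAlgHom.norm_apply_le _ f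

theorem isClosed_vanishingIdeal (Z : Set X) :
    IsClosed ((vanishingIdeal D Z).toSubmodule : Set D) :=
  Submodule.isClosed_topologicalClosure _

theorem act_mem_vanishingIdeal {Z : Set X} {f : C(X, ℂ)} (hf : ∀ z ∈ Z, f z = 0) (a : D) :
    act f a ∈ vanishingIdeal D Z :=
  Submodule.le_topologicalClosure _ (Submodule.subset_span ⟨f, a, hf, rfl⟩)

/-- A closed submodule containing the products with functions vanishing on `Z` contains the whole
ideal. -/
theorem vanishingIdeal_le {Z : Set X} {S : Submodule ℂ D} (hS : IsClosed (S : Set D))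
    (h : ∀ (f : C(X, ℂ)) (a : D), (∀ z ∈ Z, f z = 0) → act f a ∈ S) {d : D}
    (hd : d ∈ vanishingIdeal D Z) : d ∈ S := by
  refine Submodule.topologicalClosure_minimal _ (Submodule.span_le.2 ?_) hS hd
  rintro _ ⟨f, b, hf, rfl⟩
  exact h f b hf

/-- The function `f - f x` vanishes at `x`, so it maps `D` into `C_x(X) D`. -/
theorem toFibre_act (f : C(X, ℂ)) (a : D) (x : X) :
    toFibre D x (act f a) = f x • toFibre D x a := by
  rw [← map_smul, ← sub_eq_zero, ← map_sub, StarIdeal.proj_eq_zero,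
    ← algebraMap_act (X := X), ← sub_act]
  refine act_mem_vanishingIdeal (fun z hz ↦ ?_) a
  rw [Set.mem_singleton_iff.1 hz]
  simp

end Action

/-! ### Upper semicontinuity of the fibre norms and the bound on the norm -/

section Norm

variable {X D : Type*} [TopologicalSpace X] [CompactSpace X] [NonUnitalCStarAlgebra D]
  [CXAlgebra X D]

/-- An element of the span of the products with functions vanishing at `x` is small near `x`. -/
theorem exists_nhds_norm_act_lt_of_mem_span {x : X} {e : D}
    (he : e ∈ Submodule.span ℂ (vanishingProducts D {x})) {δ : ℝ} (hδ : 0 < δ) :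
    ∃ U ∈ nhds x, ∀ h : C(X, ℂ), ‖h‖ ≤ 1 → (∀ y ∉ U, h y = 0) → ‖act h e‖ < δ := by
  induction he using Submodule.span_induction generalizing δ with
  | mem e he =>
    obtain ⟨f, b, hf, rfl⟩ := he
    obtain ⟨η, hη, hηb⟩ : ∃ η > 0, η * ‖b‖ < δ := by
      refine ⟨δ / (‖b‖ + 1), by positivity, ?_⟩
      rw [div_mul_eq_mul_div, div_lt_iff₀ (by positivity)]
      nlinarith [norm_nonneg b]
    -- On this set `f` is small, and off it `h` vanishes, so `‖h * f‖ ≤ η` everywhere.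
    refine ⟨{y | ‖f y‖ < η}, ?_, fun h h1 h0 ↦ ?_⟩
    · refine (isOpen_lt (by fun_prop) continuous_const).mem_nhds ?_
      simp only [Set.mem_ofPred_eq, hf x rfl, norm_zero, hη]
    · rw [← mul_act_act]
      refine (norm_act_le _ b).trans_lt (lt_of_le_of_lt ?_ hηb)
      gcongr
      refine (ContinuousMap.norm_le _ hη.le).2 fun y ↦ ?_
      by_cases hy : ‖f y‖ < η
      · rw [ContinuousMap.mul_apply, norm_mul]
        calc ‖h y‖ * ‖f y‖ ≤ 1 * η :=
            mul_le_mul ((h.norm_coe_le_norm y).trans h1) hy.le (norm_nonneg _) zero_le_one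
          _ = η := one_mul _
      · rw [ContinuousMap.mul_apply, h0 y hy, zero_mul, norm_zero]
        exact hη.le
  | zero =>
    refine ⟨Set.univ, Filter.univ_mem, fun h _ _ ↦ ?_⟩
    have := act_smul h 0 (0 : D)
    rw [zero_smul, zero_smul] at this
    rwa [this, norm_zero]
  | add a b _ _ ha hb =>
    obtain ⟨U, hU, hU'⟩ := ha (half_pos hδ)
    obtain ⟨V, hV, hV'⟩ := hb (half_pos hδ)
    refine ⟨U ∩ V, Filter.inter_mem hU hV, fun h h1 h0 ↦ ?_⟩
    rw [act_add]
    refine (norm_add_le _ _).trans_lt ?_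
    linarith [hU' h h1 fun y hy ↦ h0 y fun hy' ↦ hy hy'.1,
      hV' h h1 fun y hy ↦ h0 y fun hy' ↦ hy hy'.2]
  | smul c a _ ha =>
    obtain ⟨U, hU, hU'⟩ := ha (δ := δ / (‖c‖ + 1)) (by positivity)
    refine ⟨U, hU, fun h h1 h0 ↦ ?_⟩
    have h2 := hU' h h1 h0
    rw [lt_div_iff₀ (by positivity)] at h2
    rw [act_smul, norm_smul]
    nlinarith [norm_nonneg (act h a)]

/-- The norm of the fibres is upper semicontinuous. -/
theorem exists_nhds_norm_act_lt {x : X} {d : D} {c : ℝ} (hd : ‖toFibre D x d‖ < c) :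
    ∃ U ∈ nhds x, ∀ h : C(X, ℂ), ‖h‖ ≤ 1 → (∀ y ∉ U, h y = 0) → ‖act h d‖ < c := by
  obtain ⟨m, hm, hmc⟩ := Submodule.Quotient.norm_mk_lt (toFibre D x d) (sub_pos.2 hd)
  rw [add_sub_cancel] at hmc
  have hmem : d - m ∈ fibreIdeal D x := (fibreIdeal D x).cl_eq_cl.1 hm.symm
  -- Half of the room below `c` is for the distance from `d - m` to the span, half for the cut-down
  -- element `e` of the span.
  have hε : 0 < (c - ‖m‖) / 2 := by linarith
  obtain ⟨e, he, hde⟩ := Metric.mem_closure_iff.1 hmem _ hε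
  obtain ⟨U, hU, hU'⟩ := exists_nhds_norm_act_lt_of_mem_span he hε
  refine ⟨U, hU, fun h h1 h0 ↦ ?_⟩
  have h2 : act h d = act h m + (act h (d - m - e) + act h e) := by
    rw [← act_add, ← act_add]
    congr 1
    abel
  have h3 : ∀ z : D, ‖act h z‖ ≤ ‖z‖ := fun z ↦
    (norm_act_le h z).trans (mul_le_of_le_one_left (norm_nonneg _) h1)
  rw [h2]
  rw [dist_eq_norm] at hde
  refine (norm_add_le _ _).trans_lt ?_
  linarith [norm_add_le (act h (d - m - e)) (act h e), h3 m, h3 (d - m - e), hU' h h1 h0]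

/-- Iterated squares stand for the powers `a ^ 2 ^ n`; since `k` acts centrally, it comes out of the
product as a power. -/
theorem iterate_mul_self_act (k : C(X, ℂ)) (a : D) (n : ℕ) :
    (fun s : D ↦ s * s)^[n] (act k a) = act (k ^ 2 ^ n) ((fun s : D ↦ s * s)^[n] a) := by
  induction n with
  | zero => simp
  | succ n ih =>
    rw [Function.iterate_succ_apply', Function.iterate_succ_apply', ih, ← act_mul, mul_act,
      ← mul_act_act, pow_succ, mul_two, pow_add]

theorem norm_iterate_mul_self_le (a : D) (n : ℕ) :
    ‖(fun s : D ↦ s * s)^[n] a‖ ≤ ‖a‖ ^ 2 ^ n := by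
  induction n with
  | zero => simp
  | succ n ih =>
    rw [Function.iterate_succ_apply', pow_succ, pow_mul, sq]
    exact (norm_mul_le _ _).trans (mul_le_mul ih ih (norm_nonneg _) (by positivity))

theorem norm_iterate_mul_self {a : D} (ha : IsSelfAdjoint a) (n : ℕ) :
    ‖(fun s : D ↦ s * s)^[n] a‖ = ‖a‖ ^ 2 ^ n := by
  have hsa : ∀ n, IsSelfAdjoint ((fun s : D ↦ s * s)^[n] a) := fun n ↦ by
    induction n with
    | zero => exact ha
    | succ n ih =>
      rw [Function.iterate_succ_apply', IsSelfAdjoint, star_mul, ih.star_eq]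
  induction n with
  | zero => simp
  | succ n ih =>
    rw [Function.iterate_succ_apply', pow_succ, pow_mul, ← ih, sq]
    nth_rw 1 [← (hsa n).star_eq]
    exact CStarRing.norm_star_mul_self

/-- A partition of unity bounds `a ^ 2 ^ n` by a sum of `t.card` local terms, each at most `c ^ 2 ^
n`. The number of terms does not depend on `n`, so a ratio `‖a‖ / c > 1` would outgrow it. If `X` is
empty the sum is empty and the argument still applies. -/
theorem norm_le_of_isSelfAdjoint [T2Space X] {a : D} (ha : IsSelfAdjoint a) {c : ℝ} (hc : 0 < c)
    (h : ∀ x : X, ‖toFibre D x a‖ < c) : ‖a‖ ≤ c := by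
  choose U hU hUa using fun x ↦ exists_nhds_norm_act_lt (h x)
  obtain ⟨t, ht⟩ := CompactSpace.elim_nhds_subcover (fun x ↦ interior (U x))
    fun x ↦ interior_mem_nhds.2 (hU x)
  obtain ⟨p, hp⟩ := PartitionOfUnity.exists_isSubordinate (s := Set.univ) isClosed_univ
    (fun x : t ↦ interior (U x)) (fun x ↦ isOpen_interior) fun y _ ↦ by
      obtain ⟨x, hx, hy⟩ := Set.mem_iUnion₂.1 (ht.ge (Set.mem_univ y))
      exact Set.mem_iUnion.2 ⟨⟨x, hx⟩, hy⟩
  let u : t → C(X, ℂ) := fun i ↦ ⟨fun x ↦ (p i x : ℂ), by fun_prop⟩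
  have hu1 : ∀ i, ‖u i‖ ≤ 1 := fun i ↦ (ContinuousMap.norm_le _ zero_le_one).2 fun x ↦ by
    change ‖(p i x : ℂ)‖ ≤ 1
    rw [Complex.norm_real, Real.norm_of_nonneg (p.nonneg i x)]
    exact p.le_one i x
  have hus : ∑ i, u i = 1 := by
    ext x
    have := p.sum_eq_one (Set.mem_univ x)
    rw [finsum_eq_sum_of_fintype] at this
    rw [ContinuousMap.sum_apply]
    change ∑ i, (p i x : ℂ) = 1
    exact_mod_cast this
  -- A Urysohn function equal to `1` on the support of `p i` and to `0` off `interior (U i)`. It can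
  -- be inserted to any power next to `u i`, so that `u i` times a power of `a` becomes `u i` times
  -- a power of `k a`, where `‖k a‖ < c`.
  have hk : ∀ i : t, ∃ k : C(X, ℂ), ‖act k a‖ < c ∧ ∀ n, u i * k ^ n = u i := fun i ↦ by
    obtain ⟨k, hk0, hk1, hk01⟩ := exists_continuous_zero_one_of_isClosed
      (isOpen_interior (s := U i)).isClosed_compl (isClosed_tsupport (p i))
      (Set.disjoint_left.2 fun y hy hy' ↦ hy (hp i hy'))
    refine ⟨⟨fun x ↦ (k x : ℂ), by fun_prop⟩, hUa i _ ?_ fun y hy ↦ ?_, fun n ↦ ?_⟩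
    · refine (ContinuousMap.norm_le _ zero_le_one).2 fun x ↦ ?_
      change ‖(k x : ℂ)‖ ≤ 1
      rw [Complex.norm_real, Real.norm_of_nonneg (hk01 x).1]
      exact (hk01 x).2
    · change (k y : ℂ) = 0
      exact_mod_cast hk0 fun hy' ↦ hy (interior_subset hy')
    · ext y
      change (p i y : ℂ) * (k y : ℂ) ^ n = p i y
      by_cases hy : y ∈ tsupport (p i)
      · rw [hk1 hy]; simp
      · rw [image_eq_zero_of_notMem_tsupport hy]; simp
  choose k hka hku using hk
  have key : ∀ n : ℕ, ‖a‖ ^ 2 ^ n ≤ t.card * c ^ 2 ^ n := fun n ↦ by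
    rw [← norm_iterate_mul_self ha, ← one_act (X := X) ((fun s : D ↦ s * s)^[n] a), ← hus, sum_act]
    refine (norm_sum_le _ _).trans ?_
    calc ∑ i, ‖act (u i) ((fun s : D ↦ s * s)^[n] a)‖ ≤ ∑ i : t, c ^ 2 ^ n :=
        Finset.sum_le_sum fun i _ ↦ by
          rw [← hku i (2 ^ n), mul_act_act, ← iterate_mul_self_act]
          calc _ ≤ 1 * ‖(fun s : D ↦ s * s)^[n] (act (k i) a)‖ :=
                (norm_act_le _ _).trans (by gcongr; exact hu1 i)
            _ ≤ ‖act (k i) a‖ ^ 2 ^ n := (one_mul _).trans_le (norm_iterate_mul_self_le _ n)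
            _ ≤ c ^ 2 ^ n := by gcongr; exact (hka i).le
      _ = t.card * c ^ 2 ^ n := by simp
  by_contra! hlt
  have h1 : 1 < ‖a‖ / c := (one_lt_div hc).2 hlt
  obtain ⟨n, hn⟩ := pow_unbounded_of_one_lt (t.card : ℝ) h1
  have h2 : (‖a‖ / c) ^ 2 ^ n ≤ t.card := by
    rw [div_pow, div_le_iff₀ (by positivity)]
    exact key n
  have h3 : (‖a‖ / c) ^ n ≤ (‖a‖ / c) ^ 2 ^ n :=
    pow_le_pow_right₀ h1.le Nat.lt_two_pow_self.le
  linarith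

/-- The norm of an element of a `C(X)`-algebra is at most the supremum of the norms in the
fibres. -/
theorem norm_le_of_forall_toFibre [T2Space X] {d : D} {c : ℝ} (hc : 0 ≤ c)
    (h : ∀ x : X, ‖toFibre D x d‖ ≤ c) : ‖d‖ ≤ c := by
  -- Enlarging `c` makes the bound positive and strict in every fibre, as the self-adjoint case
  -- requires; the C*-identity in `D` and in the fibres passes to `star d * d`.
  refine le_of_forall_gt_imp_ge_of_dense fun c' hc' ↦ ?_
  have hc0 : 0 < c' := hc.trans_lt hc'
  refine (sq_le_sq₀ (norm_nonneg _) hc0.le).1 ?_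
  rw [sq, ← CStarRing.norm_star_mul_self]
  refine norm_le_of_isSelfAdjoint (X := X) (.star_mul_self d) (pow_pos hc0 2) fun x ↦ ?_
  have h1 := ((fibreIdeal D x).quotSeminorm (isClosed_vanishingIdeal _)).map_star_mul_self
    (toFibre D x d)
  simp only [StarIdeal.quotSeminorm_apply] at h1
  rw [map_mul, map_star, h1]
  exact pow_lt_pow_left₀ ((h x).trans_lt hc') (norm_nonneg _) two_ne_zero

end Norm

end CXAlgebra

/-! ### Maximality of `‖ ‖_M` -/

namespace CStarSeminorm

/-- A C*-seminorm that vanishes on the kernel of a surjective *-homomorphism descends to the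
target. -/
theorem exists_comap_eq {R S : Type*} [NonUnitalRing R] [StarRing R] [Module ℂ R]
    [NonUnitalRing S] [StarRing S] [Module ℂ S] (p : CStarSeminorm R) {f : R →⋆ₙₐ[ℂ] S}
    (hf : Function.Surjective f) (h : ∀ x, f x = 0 → p x = 0) :
    ∃ q : CStarSeminorm S, q.comap f = p := by
  let g := Function.surjInv hf
  have hg : ∀ x, p (g (f x)) = p x := fun x ↦ p.eq_of_sub <| h _ <| by
    rw [map_sub, Function.surjInv_eq hf, sub_self]
  refine ⟨{
    -- By `hg` the value does not depend on the preimage chosen by `g`, so each axiom can be checked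
    -- on elements `f x`.
    toFun := fun y ↦ p (g y)
    map_zero' := by rw [← map_zero f, hg, p.map_zero]
    add_le' := hf.forall₂.2 fun x y ↦ by simp only [← map_add f, hg]; exact p.map_add x y
    neg' := hf.forall.2 fun x ↦ by simp only [← map_neg f, hg]; exact p.map_neg x
    smul' := fun c ↦ hf.forall.2 fun x ↦ by simp only [← map_smul f, hg]; exact p.map_smul c x
    mul_le' := hf.forall₂.2 fun x y ↦ by simp only [← map_mul f, hg]; exact p.map_mul x y
    star_mul_self' := hf.forall.2 fun x ↦ by
      simp only [← map_star f, ← map_mul f, hg]; exact p.map_star_mul_self x }, ?_⟩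
  exact CStarSeminorm.ext hg

end CStarSeminorm

namespace CXAlgebra

/-! ### Balanced seminorms and their factorization through the fibres -/

section Balanced

variable {X A B : Type*} [TopologicalSpace X] [NonUnitalCStarAlgebra A] [NonUnitalCStarAlgebra B]
  [CXAlgebra X A] [CXAlgebra X B]

/-- The canonical bilinear map from two C*-algebras to a C*-completion of their tensor product is
continuous in each variable. -/
theorem continuous_toCompletion_tmul_left (q : CStarSeminorm (A ⊗[ℂ] B)) (b : B) :
    Continuous fun a : A ↦ q.toCompletion (a ⊗ₜ[ℂ] b) :=
  AddMonoidHomClass.continuous_of_bound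
    ((q.toCompletion : A ⊗[ℂ] B →ₗ[ℂ] q.Completion) ∘ₗ (TensorProduct.mk ℂ A B).flip b) ‖b‖
    fun a ↦ by
      refine (q.norm_toCompletion _).trans_le ?_
      rw [mul_comm]
      exact q.tmul_le a b

theorem continuous_toCompletion_tmul_right (q : CStarSeminorm (A ⊗[ℂ] B)) (a : A) :
    Continuous fun b : B ↦ q.toCompletion (a ⊗ₜ[ℂ] b) :=
  AddMonoidHomClass.continuous_of_bound
    ((q.toCompletion : A ⊗[ℂ] B →ₗ[ℂ] q.Completion) ∘ₗ TensorProduct.mk ℂ A B a) ‖a‖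
    fun b ↦ (q.norm_toCompletion _).trans_le (q.tmul_le a b)

/-- By right exactness of the tensor product, the kernel of `A ⊗ B → A_x ⊗ B_x` is the sum of the
images of `C_x(X)A ⊗ B` and `A ⊗ C_x(X)B`. -/
theorem apply_eq_zero_of_evalTensor {x : X} {E : Type*} [AddCommGroup E] [Module ℂ E]
    (T : A ⊗[ℂ] B →ₗ[ℂ] E) (hA : ∀ a ∈ fibreIdeal A x, ∀ b : B, T (a ⊗ₜ b) = 0)
    (hB : ∀ a : A, ∀ b ∈ fibreIdeal B x, T (a ⊗ₜ b) = 0) {α : A ⊗[ℂ] B}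
    (hα : evalTensor A B x α = 0) : T α = 0 := by
  have hker := TensorProduct.map_ker
    (LinearMap.exact_subtype_mkQ (fibreIdeal A x).toSubmodule) (Submodule.mkQ_surjective _)
    (LinearMap.exact_subtype_mkQ (fibreIdeal B x).toSubmodule) (Submodule.mkQ_surjective _)
  have hmem : α ∈ LinearMap.ker (TensorProduct.map (fibreIdeal A x).toSubmodule.mkQ
    (fibreIdeal B x).toSubmodule.mkQ) := hα
  rw [hker] at hmem
  suffices h : LinearMap.range (LinearMap.lTensor A (fibreIdeal B x).toSubmodule.subtype) ⊔
      LinearMap.range (LinearMap.rTensor B (fibreIdeal A x).toSubmodule.subtype) ≤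
        LinearMap.ker T from h hmem
  refine sup_le ?_ ?_
  · rw [LinearMap.range_le_ker_iff]
    exact TensorProduct.ext' fun a b ↦ hB a b b.2
  · rw [LinearMap.range_le_ker_iff]
    exact TensorProduct.ext' fun a b ↦ hA a a.2 b

/-- A real supremum dominates its terms only for a bounded family; the maximal seminorm of `A ⊗ B`
is the bound. -/
theorem maxCStarSeminorm_evalTensor_le (x : X) (α : A ⊗[ℂ] B) :
    maxCStarSeminorm (Fibre A x ⊗[ℂ] Fibre B x) (evalTensor A B x α) ≤ seminormM X A B α := by
  refine le_ciSup (f := fun x : X ↦ maxCStarSeminorm (Fibre A x ⊗[ℂ] Fibre B x)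
    (evalTensor A B x α)) ⟨maxCStarSeminorm (A ⊗[ℂ] B) α, ?_⟩ x
  rintro _ ⟨y, rfl⟩
  exact le_maxCStarSeminorm ((maxCStarSeminorm _).comap (evalTensor A B y)) α

variable [CompactSpace X] [T2Space X]

/-- A C*-seminorm on `A ⊗ B` for which the two actions of `C(X)` agree is at most `‖ ‖_M`. -/
theorem le_seminormM_of_balanced (q : CStarSeminorm (A ⊗[ℂ] B))
    (hq : ∀ (f : C(X, ℂ)) (a : A) (b : B), q (act f a ⊗ₜ b - a ⊗ₜ act f b) = 0) :
    q ≤ seminormM X A B := by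
  -- The structure comes from the action on the first factor; `hbal` says that the action on the
  -- second factor induces the same one.
  let _ : CXAlgebra X q.Completion := actionStructure q (actLeft A B) star_actLeft_mul
    toMultiplier fun f ↦ actLeft_mul (mem_center f)
  have hact : ∀ (f : C(X, ℂ)) (a : A) (b : B),
      act f (q.toCompletion (a ⊗ₜ b)) = q.toCompletion (act f a ⊗ₜ b) := fun f a b ↦
    actionStructure_coe q (actLeft A B) star_actLeft_mul toMultiplier
      (fun f ↦ actLeft_mul (mem_center f)) f (a ⊗ₜ b)
  have hbal : ∀ (f : C(X, ℂ)) (a : A) (b : B),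
      q.toCompletion (a ⊗ₜ act f b) = q.toCompletion (act f a ⊗ₜ b) := fun f a b ↦ by
    rw [eq_comm, ← sub_eq_zero, ← map_sub, ← norm_eq_zero, q.norm_toCompletion, hq]
  refine CStarSeminorm.le_def.2 fun α ↦ ?_
  rw [← q.norm_toCompletion]
  refine norm_le_of_forall_toFibre (X := X) ((seminormM X A B).nonneg α) fun x ↦ ?_
  let P : A ⊗[ℂ] B →⋆ₙₐ[ℂ] Fibre q.Completion x := (toFibre q.Completion x).comp q.toCompletion
  have hP : ∀ β, evalTensor A B x β = 0 → P β = 0 := fun β hβ ↦ by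
    have hI := isClosed_vanishingIdeal (D := q.Completion) ({x} : Set X)
    refine apply_eq_zero_of_evalTensor (P : A ⊗[ℂ] B →ₗ[ℂ] Fibre q.Completion x) (fun a ha b ↦ ?_)
      (fun a b hb ↦ ?_) hβ
    · refine (StarIdeal.proj_eq_zero _).2 ?_
      -- The elements `a` for which `a ⊗ b` lands in the ideal of the fibre form a closed subspace,
      -- so it is enough to treat the products `f a` with `f x = 0`.
      let S : Submodule ℂ A := (fibreIdeal q.Completion x).toSubmodule.comap
        ((q.toCompletion : A ⊗[ℂ] B →ₗ[ℂ] q.Completion) ∘ₗ (TensorProduct.mk ℂ A B).flip b)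
      refine vanishingIdeal_le (S := S)
        (hI.preimage (continuous_toCompletion_tmul_left q b)) (fun f a hf ↦ ?_) ha
      change q.toCompletion (act f a ⊗ₜ b) ∈ fibreIdeal q.Completion x
      rw [← hact]
      exact act_mem_vanishingIdeal hf _
    · refine (StarIdeal.proj_eq_zero _).2 ?_
      let S : Submodule ℂ B := (fibreIdeal q.Completion x).toSubmodule.comap
        ((q.toCompletion : A ⊗[ℂ] B →ₗ[ℂ] q.Completion) ∘ₗ TensorProduct.mk ℂ A B a)
      refine vanishingIdeal_le (S := S)
        (hI.preimage (continuous_toCompletion_tmul_right q a)) (fun f b hf ↦ ?_) hb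
      change q.toCompletion (a ⊗ₜ act f b) ∈ fibreIdeal q.Completion x
      rw [hbal, ← hact]
      exact act_mem_vanishingIdeal hf _
  -- The fibre norm, seen on `A ⊗ B`, vanishes on the kernel of the evaluation at `x`. It therefore
  -- comes from a C*-seminorm `r` on `A_x ⊗ B_x`, to which maximality applies.
  let s := ((fibreIdeal q.Completion x).quotSeminorm (isClosed_vanishingIdeal _)).comap P
  obtain ⟨r, hr⟩ := s.exists_comap_eq
    (tensorMap_surjective (fibreIdeal A x).proj_surjective (fibreIdeal B x).proj_surjective)
    (fun β hβ ↦ by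
      change ‖P β‖ = 0
      rw [hP β hβ, norm_zero])
  calc ‖toFibre q.Completion x (q.toCompletion α)‖ = s α := rfl
    _ = r (evalTensor A B x α) := by rw [← hr]; rfl
    _ ≤ maxCStarSeminorm _ (evalTensor A B x α) := le_maxCStarSeminorm r _
    _ ≤ seminormM X A B α := maxCStarSeminorm_evalTensor_le x α

/-- In both fibres at `x` the function acts as the scalar `f x`, which moves across the tensor sign.
This makes every C*-seminorm on the quotient by `J(A, B)` balanced. -/
theorem act_tmul_sub_mem_idealJ (f : C(X, ℂ)) (a : A) (b : B) :
    act f a ⊗ₜ b - a ⊗ₜ act f b ∈ idealJ X A B := fun x ↦ by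
  rw [map_sub, tensorMap_tmul, tensorMap_tmul, toFibre_act, toFibre_act, TensorProduct.smul_tmul,
    sub_self]

variable (X A B) in
/-- `‖ ‖_M` is the greatest C*-norm on the quotient of `A ⊗ B` by `J(A, B)`. -/
theorem isGreatest_normM :
    IsGreatest {q : CStarSeminorm (idealJ X A B).Quot | q.IsNorm} (normM X A B) := by
  constructor
  · intro u hu
    obtain ⟨α, rfl⟩ := (idealJ X A B).proj_surjective u
    refine (StarIdeal.proj_eq_zero _).2 fun x ↦ ?_
    refine maxCStarSeminorm_quot_tensor_isNorm _ _ (isClosed_vanishingIdeal _)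
      (isClosed_vanishingIdeal _) _ (le_antisymm ?_ (CStarSeminorm.nonneg _ _))
    exact (maxCStarSeminorm_evalTensor_le x α).trans_eq hu
  · intro q _
    refine CStarSeminorm.le_def.2 fun u ↦ ?_
    obtain ⟨α, rfl⟩ := (idealJ X A B).proj_surjective u
    refine le_seminormM_of_balanced (q.comap (idealJ X A B).proj) (fun f a b ↦ ?_) α
    rw [CStarSeminorm.comap_apply, (StarIdeal.proj_eq_zero _).2 (act_tmul_sub_mem_idealJ f a b),
      q.map_zero]

end Balanced

end CXAlgebra

/-! ### Identification of the completion for `‖ ‖_M` -/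

namespace CStarSeminorm

variable {R : Type*} [NonUnitalRing R] [StarRing R] [Module ℂ R] [IsScalarTower ℂ R R]
  [SMulCommClass ℂ R R] [StarModule ℂ R]

/-- A linear map to a Banach space that is contractive for `p` extends to a contraction of the
completion. -/
theorem exists_extension {E : Type*} [NormedAddCommGroup E] [NormedSpace ℂ E] [CompleteSpace E]
    (p : CStarSeminorm R) (T : R →ₗ[ℂ] E) (hT : ∀ r, ‖T r‖ ≤ p r) :
    ∃ T' : p.Completion →L[ℂ] E, (∀ r, T' (p.toCompletion r) = T r) ∧ ∀ z, ‖T' z‖ ≤ ‖z‖ := by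
  have hT' : ∀ r, ‖T r‖ ≤ 1 * ‖(p.toCompletion : R →ₗ[ℂ] p.Completion) r‖ := fun r ↦ by
    rw [one_mul]
    exact (hT r).trans_eq (p.norm_toCompletion r).symm
  refine ⟨T.extendOfNorm (p.toCompletion : R →ₗ[ℂ] p.Completion), fun r ↦
    LinearMap.extendOfNorm_eq (e := (p.toCompletion : R →ₗ[ℂ] p.Completion))
      p.denseRange_toCompletion ⟨1, hT'⟩ r, fun z ↦ ?_⟩
  simpa only [one_mul] using LinearMap.norm_extendOfNorm_apply_le
    (e := (p.toCompletion : R →ₗ[ℂ] p.Completion)) p.denseRange_toCompletion 1 hT' z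

/-- A *-homomorphism with dense range to a C*-algebra, isometric for `p`, identifies the completion
for `p` with the target. -/
theorem exists_starAlgEquiv {E : Type*} [NonUnitalCStarAlgebra E] (p : CStarSeminorm R)
    (ψ : R →⋆ₙₐ[ℂ] E) (hψ : ∀ r, ‖ψ r‖ = p r) (hd : DenseRange ψ) :
    ∃ Φ : p.Completion ≃⋆ₐ[ℂ] E, (∀ z, ‖Φ z‖ = ‖z‖) ∧ ∀ r, Φ (p.toCompletion r) = ψ r := by
  obtain ⟨T, hT, -⟩ := p.exists_extension (ψ : R →ₗ[ℂ] E) fun r ↦ (hψ r).le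
  replace hT : ∀ r, T (p.toCompletion r) = ψ r := hT
  have hnorm : ∀ z, ‖T z‖ = ‖z‖ := fun z ↦
    isClosed_property p.denseRange_toCompletion
      (isClosed_eq (by fun_prop) (by fun_prop) : IsClosed {z | ‖T z‖ = ‖z‖})
      (fun r ↦ by rw [hT, hψ, p.norm_toCompletion]) z
  have hmul : ∀ z w, T (z * w) = T z * T w :=
    p.induction₂ (isClosed_eq (T.continuous.comp (continuous_fst.mul continuous_snd))
      ((T.continuous.comp continuous_fst).mul (T.continuous.comp continuous_snd))) fun r s ↦ by
      rw [← map_mul, hT, hT, hT, map_mul]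
  have hstar : ∀ z, T (star z) = star (T z) := fun z ↦
    isClosed_property p.denseRange_toCompletion
      (isClosed_eq (by fun_prop) (by fun_prop) : IsClosed {z | T (star z) = star (T z)})
      (fun r ↦ by rw [← map_star, hT, hT, map_star]) z
  have hiso : Isometry T := AddMonoidHomClass.isometry_of_norm T hnorm
  -- The isometric image of a complete space is closed, and it contains the dense range of `ψ`.
  have hsurj : Function.Surjective T := by
    refine Set.range_eq_univ.1 (Set.eq_univ_of_univ_subset ?_)
    rw [← hd.closure_range]
    refine closure_minimal ?_ hiso.isClosedEmbedding.isClosed_range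
    rintro _ ⟨r, rfl⟩
    exact ⟨_, hT r⟩
  let F : p.Completion →⋆ₙₐ[ℂ] E :=
    { toFun := T
      map_smul' := fun c z ↦ map_smul T c z
      map_zero' := map_zero T
      map_add' := map_add T
      map_mul' := hmul
      map_star' := hstar }
  exact ⟨StarAlgEquiv.ofBijective F ⟨hiso.injective, hsurj⟩, hnorm, hT⟩

end CStarSeminorm

/-- The quotient of a C*-algebra by a closed ideal is a C*-algebra. -/
abbrev StarIdeal.quotCStarAlgebra {D : Type*} [NonUnitalCStarAlgebra D] (I : StarIdeal D)
    (hI : IsClosed (I.toSubmodule : Set D)) : NonUnitalCStarAlgebra I.Quot :=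
  { (inferInstance : NonUnitalRing I.Quot), (inferInstance : StarRing I.Quot),
    Submodule.Quotient.normedAddCommGroup I.toSubmodule,
    Submodule.Quotient.normedSpace I.toSubmodule ℂ with
    norm_mul_le := (I.quotSeminorm hI).map_mul
    toCompleteSpace := Submodule.Quotient.completeSpace I.toSubmodule
    norm_mul_self_le := fun x ↦
      ((I.quotSeminorm hI).map_star_mul_self x |>.trans (sq _)).ge
    smul_assoc := smul_assoc
    smul_comm := smul_comm
    star_smul := star_smul }

namespace CXAlgebra

/-! ### The diagonal ideal and evaluation in the fibres -/

section Diagonal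

variable {X A B : Type*} [TopologicalSpace X] [CompactSpace X] [T2Space X]
  [NonUnitalCStarAlgebra A] [NonUnitalCStarAlgebra B] [CXAlgebra X A] [CXAlgebra X B]

theorem exists_apply_ne {x y : X} (h : x ≠ y) : ∃ f : C(X, ℂ), f x ≠ f y := by
  obtain ⟨k, hk0, hk1, -⟩ := exists_continuous_zero_one_of_isClosed
    (isClosed_singleton (x := x)) (isClosed_singleton (x := y)) (Set.disjoint_singleton.2 h)
  refine ⟨⟨fun z ↦ (k z : ℂ), by fun_prop⟩, ?_⟩
  change (k x : ℂ) ≠ k y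
  rw [hk0 rfl, hk1 rfl]
  simp

/-- A *-subalgebra of `C(X × X)` that contains the functions of one variable is dense. -/
theorem topologicalClosure_eq_top_of_comp_mem (S : StarSubalgebra ℂ C(X × X, ℂ))
    (h : ∀ f g : C(X, ℂ), f.comp .fst * g.comp .snd ∈ S) : S.topologicalClosure = ⊤ := by
  refine ContinuousMap.starSubalgebra_topologicalClosure_eq_top_of_separatesPoints S ?_
  rintro ⟨x₁, x₂⟩ ⟨y₁, y₂⟩ hne
  by_cases h1 : x₁ = y₁
  · have h2 : x₂ ≠ y₂ := fun h2 ↦ hne (Prod.ext h1 h2)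
    obtain ⟨f, hf⟩ := exists_apply_ne h2
    exact ⟨_, ⟨_, h 1 f, rfl⟩, by simpa using hf⟩
  · obtain ⟨f, hf⟩ := exists_apply_ne h1
    exact ⟨_, ⟨_, h f 1, rfl⟩, by simpa using hf⟩

/-- A continuous linear extension to `A ⊗_max B` of the evaluation at `y` turns the action of
`C(X × X)` into the evaluation at `(y, y)`. -/
theorem apply_act_of_evalTensor {E : Type*} [NormedAddCommGroup E] [NormedSpace ℂ E] {y : X}
    (π : MaxTensor A B →L[ℂ] E) (T : Fibre A y ⊗[ℂ] Fibre B y →ₗ[ℂ] E)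
    (hπ : ∀ α, π ((maxCStarSeminorm (A ⊗[ℂ] B)).toCompletion α) = T (evalTensor A B y α))
    (F : C(X × X, ℂ)) (z : MaxTensor A B) : π (act F z) = F (y, y) • π z := by
  have hprod : ∀ (f g : C(X, ℂ)) (z : MaxTensor A B),
      π (act (f.comp .fst * g.comp .snd : C(X × X, ℂ)) z) = (f y * g y) • π z := fun f g z ↦ by
    refine isClosed_property (maxCStarSeminorm (A ⊗[ℂ] B)).denseRange_toCompletion
      (isClosed_eq (π.continuous.comp (continuous_act _)) (π.continuous.const_smul _) :
        IsClosed {z | π (act (f.comp .fst * g.comp .snd : C(X × X, ℂ)) z) = (f y * g y) • π z})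
      (fun α ↦ ?_) z
    induction α with
    | zero =>
      rw [map_zero, map_zero, smul_zero, ← zero_smul ℂ (0 : MaxTensor A B), act_smul, zero_smul,
        map_zero]
    | add α β hα hβ => rw [map_add, act_add, map_add, map_add, smul_add, hα, hβ]
    | tmul a b =>
      rw [act_tmul, hπ, hπ, tensorMap_tmul, tensorMap_tmul, toFibre_act, toFibre_act,
        TensorProduct.smul_tmul_smul, map_smul]
  let P : C(X × X, ℂ) → Prop := fun F ↦ ∀ z, π (act F z) = F (y, y) • π z
  have hmul : ∀ F G, P F → P G → P (F * G) := fun F G hF hG z ↦ by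
    rw [mul_act_act, hF, hG, smul_smul, ContinuousMap.mul_apply]
  have hadd : ∀ F G, P F → P G → P (F + G) := fun F G hF hG z ↦ by
    rw [add_act, map_add, hF, hG, ← add_smul, ContinuousMap.add_apply]
  have halg : ∀ c, P (algebraMap ℂ _ c) := fun c z ↦ by
    rw [algebraMap_act, map_smul]; simp
  -- Nothing relates the linear map `π` to the involution, so `P (star F)` is imposed alongside `P
  -- F` to make the set stable under `star`.
  let S : StarSubalgebra ℂ C(X × X, ℂ) :=
    { carrier := {F | P F ∧ P (star F)}
      mul_mem' := fun {F G} hF hG ↦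
        ⟨hmul F G hF.1 hG.1, by rw [star_mul]; exact hmul _ _ hG.2 hF.2⟩
      add_mem' := fun {F G} hF hG ↦
        ⟨hadd F G hF.1 hG.1, by rw [star_add]; exact hadd _ _ hF.2 hG.2⟩
      algebraMap_mem' := fun c ↦ ⟨halg c, by rw [← algebraMap_star_comm]; exact halg _⟩
      star_mem' := fun {F} hF ↦ ⟨hF.2, by rw [star_star]; exact hF.1⟩ }
  have htop : S.topologicalClosure = ⊤ := topologicalClosure_eq_top_of_comp_mem S fun f g ↦
    ⟨hprod f g, fun z ↦ by
      have hs : star (f.comp .fst * g.comp .snd : C(X × X, ℂ)) =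
          (star f).comp .fst * (star g).comp .snd := by
        ext w; simp
      rw [hs, hprod]
      rfl⟩
  have hF : F ∈ closure (S : Set C(X × X, ℂ)) := by
    rw [← StarSubalgebra.topologicalClosure_coe, htop]
    trivial
  have hcont : Continuous fun F : C(X × X, ℂ) ↦ π (act F z) := by
    refine π.continuous.comp (AddMonoidHomClass.continuous_of_bound
      (AddMonoidHom.mk' (fun F : C(X × X, ℂ) ↦ act F z) fun F G ↦ add_act F G z) ‖z‖ fun F ↦ ?_)
    rw [mul_comm]
    exact norm_act_le F z
  exact closure_minimal (fun G hG ↦ hG.1 z)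
    (isClosed_eq hcont (by fun_prop) :
      IsClosed {F : C(X × X, ℂ) | π (act F z) = F (y, y) • π z}) hF

/-- The norm of an element of `A ⊗ B` in the maximal `C(X)`-tensor product is `‖ ‖_M`. -/
theorem norm_proj_diagonalIdeal (α : A ⊗[ℂ] B) :
    ‖(diagonalIdeal X A B).proj ((maxCStarSeminorm (A ⊗[ℂ] B)).toCompletion α)‖ =
      seminormM X A B α := by
  refine le_antisymm ?_ (Real.iSup_le (fun y ↦ ?_) (norm_nonneg _))
  -- This seminorm is balanced because `f ⊗ 1 - 1 ⊗ f` vanishes on the diagonal.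
  · let q : CStarSeminorm (A ⊗[ℂ] B) :=
      ((diagonalIdeal X A B).quotSeminorm (isClosed_vanishingIdeal _)).comap
        ((diagonalIdeal X A B).proj.comp (maxCStarSeminorm (A ⊗[ℂ] B)).toCompletion)
    refine le_seminormM_of_balanced q (fun f a b ↦ ?_) α
    have hmem : (maxCStarSeminorm (A ⊗[ℂ] B)).toCompletion (act f a ⊗ₜ b - a ⊗ₜ act f b) ∈
        diagonalIdeal X A B := by
      have h1 := act_tmul X A B f 1 a b
      have h2 := act_tmul X A B 1 f a b
      rw [one_act] at h1 h2
      rw [map_sub, ← h1, ← h2, ← sub_act]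
      refine act_mem_vanishingIdeal ?_ _
      rintro ⟨x, y⟩ (rfl : x = y)
      simp
    exact (congrArg norm ((StarIdeal.proj_eq_zero _).2 hmem)).trans norm_zero
  · let m := maxCStarSeminorm (Fibre A y ⊗[ℂ] Fibre B y)
    let T : Fibre A y ⊗[ℂ] Fibre B y →ₗ[ℂ] m.Completion := m.toCompletion
    -- The contraction `A ⊗_max B → A_y ⊗_max B_y`. It kills the diagonal ideal, so its value at any
    -- lift `w` of the class of `α` is the image of `α`; lifts of almost minimal norm give the
    -- inequality.
    obtain ⟨π, hπ, hπ'⟩ := (maxCStarSeminorm (A ⊗[ℂ] B)).exists_extension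
      (T ∘ₗ (evalTensor A B y : A ⊗[ℂ] B →ₗ[ℂ] _)) fun r ↦
        (m.norm_toCompletion _).trans_le (le_maxCStarSeminorm (m.comap (evalTensor A B y)) r)
    have hker : ∀ z ∈ diagonalIdeal X A B, π z = 0 := fun z hz ↦
      vanishingIdeal_le (S := LinearMap.ker (π : MaxTensor A B →ₗ[ℂ] m.Completion))
        (isClosed_eq π.continuous continuous_const) (fun F z hF ↦ by
          change π (act F z) = 0
          rw [apply_act_of_evalTensor π T hπ, hF _ rfl, zero_smul]) hz
    refine le_of_forall_pos_le_add fun ε hε ↦ ?_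
    obtain ⟨w, hw, hwε⟩ := Submodule.Quotient.norm_mk_lt
      ((diagonalIdeal X A B).proj ((maxCStarSeminorm (A ⊗[ℂ] B)).toCompletion α)) hε
    have h1 : π w = T (evalTensor A B y α) := by
      have := hker _ ((diagonalIdeal X A B).cl_eq_cl.1 hw)
      rw [map_sub, sub_eq_zero, hπ] at this
      exact this
    calc m (evalTensor A B y α) = ‖π w‖ := by rw [h1]; exact (m.norm_toCompletion _).symm
      _ ≤ ‖w‖ := hπ' w
      _ ≤ _ := hwε.le

variable (X A B) in
/-- The canonical *-homomorphism from the quotient of `A ⊗ B` by `J(A, B)` to the maximal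
`C(X)`-tensor product. -/
def quotToMaxCXTensor : (idealJ X A B).Quot →⋆ₙₐ[ℂ] MaxCXTensor X A B :=
  let ψ := (diagonalIdeal X A B).proj.comp (maxCStarSeminorm (A ⊗[ℂ] B)).toCompletion
  let L : (idealJ X A B).Quot →ₗ[ℂ] MaxCXTensor X A B :=
    (idealJ X A B).toSubmodule.liftQ (ψ : A ⊗[ℂ] B →ₗ[ℂ] MaxCXTensor X A B) fun α hα ↦ by
      -- On `J(A, B)` the quotient norm of the image is `‖α‖_M = 0`, and the diagonal ideal is
      -- closed, so the image itself is `0`.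
      have h : ‖ψ α‖ = 0 := (norm_proj_diagonalIdeal α).trans (seminormM_eq_zero X A B α hα)
      have hcl : IsClosed ((diagonalIdeal X A B).toSubmodule : Set (MaxTensor A B)) :=
        isClosed_vanishingIdeal _
      exact (diagonalIdeal X A B).quotSeminorm_isNorm hcl _ h
  { toFun := L
    map_smul' := fun c u ↦ map_smul L c u
    map_zero' := map_zero L
    map_add' := map_add L
    map_mul' := by rintro ⟨α⟩ ⟨β⟩; exact map_mul ψ α β
    map_star' := by rintro ⟨α⟩; exact map_star ψ α }

theorem norm_quotToMaxCXTensor (u : (idealJ X A B).Quot) :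
    ‖quotToMaxCXTensor X A B u‖ = normM X A B u := by
  obtain ⟨α, rfl⟩ := (idealJ X A B).proj_surjective u
  exact norm_proj_diagonalIdeal α

theorem denseRange_quotToMaxCXTensor : DenseRange (quotToMaxCXTensor X A B) := by
  have h : DenseRange ((diagonalIdeal X A B).proj ∘
      (maxCStarSeminorm (A ⊗[ℂ] B)).toCompletion) :=
    (diagonalIdeal X A B).proj_surjective.denseRange.comp
      (maxCStarSeminorm (A ⊗[ℂ] B)).denseRange_toCompletion
      (continuous_quot_mk : Continuous (diagonalIdeal X A B).proj)
  refine h.mono ?_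
  rintro _ ⟨α, rfl⟩
  exact ⟨(idealJ X A B).proj α, rfl⟩

end Diagonal

end CXAlgebra

end

open CXAlgebra in
theorem mainTheorem2 {X A₁ A₂ : Type*} [TopologicalSpace X] [CompactSpace X] [T2Space X]
    [NonUnitalCStarAlgebra A₁] [NonUnitalCStarAlgebra A₂] [CXAlgebra X A₁] [CXAlgebra X A₂] :
    IsGreatest {q : CStarSeminorm (idealJ X A₁ A₂).Quot | q.IsNorm} (normM X A₁ A₂) ∧
    ∃ Φ : (normM X A₁ A₂).Completion ≃⋆ₐ[ℂ] MaxCXTensor X A₁ A₂,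
      (∀ y, ‖Φ y‖ = ‖y‖) ∧
      ∀ α : A₁ ⊗[ℂ] A₂,
        Φ ((normM X A₁ A₂).toCompletion ((idealJ X A₁ A₂).proj α)) =
          (diagonalIdeal X A₁ A₂).proj ((maxCStarSeminorm (A₁ ⊗[ℂ] A₂)).toCompletion α) := by
  refine ⟨isGreatest_normM X A₁ A₂, ?_⟩
  -- The C*-structure given to the target has the quotient norm as its norm, so the isometry
  -- obtained is for the norm of the statement.
  obtain ⟨Φ, hΦ, hΦ'⟩ := @CStarSeminorm.exists_starAlgEquiv _ _ _ _ _ _ _ (MaxCXTensor X A₁ A₂)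
    ((diagonalIdeal X A₁ A₂).quotCStarAlgebra (isClosed_vanishingIdeal _)) (normM X A₁ A₂)
    (quotToMaxCXTensor X A₁ A₂) norm_quotToMaxCXTensor denseRange_quotToMaxCXTensor
  exact ⟨Φ, hΦ, fun α ↦ hΦ' _⟩
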